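/- **Theorem 1.1 (light cone / maximal propagation velocity bound).** Let $n\in\mathbb N$, let $H$ be a self-adjoint operator on $L^2(\mathbb R^n)$, let $e^{-iHt}$ be the strongly continuous unitary group generated by $-iH$, and for $\xi\in\mathbb R^n$ let $T_\xi$ be the unitary operator of multiplication by $e^{-i\xi\cdot x}$ and $H_\xi:=T_\xi H T_\xi^{-1}$. For $a>0$ put $\mathcal S_a^n=\{\zeta\in\mathbb C^n:\ |\mathrm{Im}\,\zeta_j|<a\ \ \forall j\}$. Assume Condition (A): the family $H_\xi$, $\xi\in\mathbb R^n$, has an analytic continuation $H_\zeta$ from $\mathbb R^n$ to $\mathcal S_a^n$ in the sense of Kato (each $H_\zeta$ is closed and densely defined, and for every $\zeta_0\in\mathcal S_a^n$ there is $z\in\mathbb C$ such that for all $\zeta$ near $\zeta_0$ the number $z$ lies in the resolvent set of $H_\zeta$ and $(H_\zeta-z)^{-1}$ is a norm-analytic function of $\zeta$), and the imaginary parts $\mathrm{Im}\,H_\zeta=\frac1{2i}(H_\zeta-H_\zeta^*)$ are bounded operators (that is, $H_\zeta$ and $H_\zeta^*$ have the same domain and differ there by a bounded operator), with norms bounded uniformly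 on every smaller polystrip $\mathcal S_{a'}^n$, $a'<a$. Let $\mu\in(0,a)$ and $$c:=\sup_{y\in\mathbb R^n,\ |y|=\mu}\ \frac{\sup(\mathrm{Im}\,H_{iy})}{\mu},\qquad \sup B:=\sup_{u\in D(B),\,\|u\|=1}\langle u,Bu\rangle .$$ Then for every $\mu'\in(0,\mu)$, every pair of disjoint measurable sets $X,Y\subset\mathbb R^n$ and every $t\in\mathbb R$, $$\|\chi_X\,e^{-iHt}\,\chi_Y\|\ \le\ C\,e^{-\mu'(d_{XY}-c'|t|)},\qquad c'=\frac{\mu c}{\mu'},$$ where $\chi_X$ is the operator of multiplication by the characteristic function of $X$, $d_{XY}=\inf\{|x-y|:x\in X,\ y\in Y\}$ is the distance between $X$ and $Y$, $\|\cdot\|$ is the operator norm, and $C>0$ is a constant depending only on $\frac{\mu}{\mu'}-1$, $\mu$ and $n$. -/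

import Mathlib

open MeasureTheory Filter Topology Complex
open scoped ENNReal

noncomputable section

/-- The Hilbert space `L²(ℝⁿ)` of complex-valued functions, for Lebesgue measure. -/
abbrev L2Rn (n : ℕ) : Type :=
  Lp ℂ 2 (volume : Measure (EuclideanSpace ℝ (Fin n)))

/-- The bounded operator on `L²(ℝⁿ)` of multiplication by a function `m ∈ L^∞`. -/
def mulOp {n : ℕ} (m : EuclideanSpace ℝ (Fin n) → ℂ) (hm : MemLp m ∞ volume) :
    L2Rn n →L[ℂ] L2Rn n :=
  (ContinuousLinearMap.mul ℂ ℂ).holderL volume ∞ 2 2 (hm.toLp m)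

theorem memLp_top_indicator_one {n : ℕ} {X : Set (EuclideanSpace ℝ (Fin n))}
    (hX : MeasurableSet X) :
    MemLp (X.indicator fun _ => (1 : ℂ)) ∞ (volume : Measure (EuclideanSpace ℝ (Fin n))) :=
  (memLp_top_const (1 : ℂ)).indicator hX

/-- The operator `χ_X` of multiplication by the characteristic function of `X`. -/
def chi {n : ℕ} (X : Set (EuclideanSpace ℝ (Fin n))) (hX : MeasurableSet X) :
    L2Rn n →L[ℂ] L2Rn n :=
  mulOp (X.indicator fun _ => (1 : ℂ)) (memLp_top_indicator_one hX)

theorem memLp_top_character {n : ℕ} (ξ : EuclideanSpace ℝ (Fin n)) :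
    MemLp (fun x : EuclideanSpace ℝ (Fin n) => Complex.exp (-I * (inner ℝ ξ x : ℝ))) ∞
      volume := by
  refine memLp_top_of_bound (by fun_prop) 1 (Eventually.of_forall fun x => ?_)
  have h : -I * ((inner ℝ ξ x : ℝ) : ℂ) = ((-(inner ℝ ξ x : ℝ) : ℝ) : ℂ) * I := by
    push_cast; ring
  rw [h, Complex.norm_exp_ofReal_mul_I]

/-- The unitary operator `T_ξ` of multiplication by `x ↦ e^{-iξ·x}`; its inverse is `T_{-ξ}`. -/
def phaseOp {n : ℕ} (ξ : EuclideanSpace ℝ (Fin n)) : L2Rn n →L[ℂ] L2Rn n :=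
  mulOp (fun x => Complex.exp (-I * (inner ℝ ξ x : ℝ))) (memLp_top_character ξ)

/-- The family `H_ξ = T_ξ H T_ξ⁻¹`, `ξ ∈ ℝⁿ`, with its natural domain
`{ψ | T_ξ⁻¹ ψ ∈ D(H)}`. -/
def conjugated {n : ℕ} (H : L2Rn n →ₗ.[ℂ] L2Rn n) (ξ : EuclideanSpace ℝ (Fin n)) :
    L2Rn n →ₗ.[ℂ] L2Rn n where
  domain := H.domain.comap (phaseOp (-ξ)).toLinearMap
  toFun :=
    { toFun := fun ψ => phaseOp ξ (H ⟨phaseOp (-ξ) ψ, ψ.2⟩)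
      map_add' := fun ψ φ => by
        rw [← map_add, ← LinearPMap.map_add]
        congr 2
        exact Subtype.ext (map_add (phaseOp (-ξ)) (ψ : L2Rn n) φ)
      map_smul' := fun z ψ => by
        rw [RingHom.id_apply, ← map_smul, ← LinearPMap.map_smul]
        congr 2
        exact Subtype.ext (map_smul (phaseOp (-ξ)) z (ψ : L2Rn n)) }

/-- The polystrip `S_a^n = {ζ ∈ ℂⁿ : |Im ζ_j| < a for all j}`. -/
def polystrip (n : ℕ) (a : ℝ) : Set (Fin n → ℂ) :=
  {ζ | ∀ j, |(ζ j).im| < a}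

section Operators

variable {E : Type*} [NormedAddCommGroup E] [InnerProductSpace ℂ E]

/-- `R = (A - z)⁻¹`: the bounded operator `R` maps into `D(A)` and is a two-sided inverse of
`A - z`; thus `z` lies in the resolvent set of `A`. -/
def IsResolvent (A : E →ₗ.[ℂ] E) (z : ℂ) (R : E →L[ℂ] E) : Prop :=
  (∀ φ : E, ∃ h : R φ ∈ A.domain, A ⟨R φ, h⟩ - z • R φ = φ) ∧
    ∀ ψ : A.domain, R (A ψ - z • (ψ : E)) = ψ

/-- Analyticity in the sense of Kato on an open set `Ω ⊆ ℂⁿ`: every `F ζ`, `ζ ∈ Ω`, is closed and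
densely defined, and for every `ζ₀ ∈ Ω` there is a `z` which is in the resolvent set of `F ζ` for
all `ζ` near `ζ₀` and for which `(F ζ - z)⁻¹` is a norm-analytic function of `ζ` near `ζ₀`. -/
def IsKatoAnalyticOn {n : ℕ} (F : (Fin n → ℂ) → E →ₗ.[ℂ] E) (Ω : Set (Fin n → ℂ)) : Prop :=
  (∀ ζ ∈ Ω, (F ζ).IsClosed ∧ Dense ((F ζ).domain : Set E)) ∧
    ∀ ζ₀ ∈ Ω, ∃ (z : ℂ) (R : (Fin n → ℂ) → E →L[ℂ] E),
      (∀ᶠ ζ in 𝓝 ζ₀, IsResolvent (F ζ) z (R ζ)) ∧ AnalyticAt ℂ R ζ₀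

/-- `sup A = sup {⟨u, A u⟩ : u ∈ D(A), ‖u‖ = 1}`. -/
def opSup (A : E →ₗ.[ℂ] E) : ℝ :=
  sSup {r | ∃ u : A.domain, ‖(u : E)‖ = 1 ∧ r = (inner ℂ (u : E) (A u)).re}

/-- `U t = e^{-iHt}` for all `t`: `U` is a strongly continuous one-parameter unitary group whose
infinitesimal generator, with its exact domain, is `-iH`. -/
structure IsUnitaryGroupOf (H : E →ₗ.[ℂ] E) (U : ℝ → E →L[ℂ] E) : Prop where
  zero : U 0 = 1
  add : ∀ s t, U (s + t) = U s * U t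
  norm_apply : ∀ t ψ, ‖U t ψ‖ = ‖ψ‖
  continuous : ∀ ψ, Continuous fun t => U t ψ
  generator : ∀ ψ φ, (ψ, φ) ∈ H.graph ↔ HasDerivAt (fun t => U t ψ) (-I • φ) 0

variable [CompleteSpace E]

/-- `Im A = (A - A*) / (2i)`, on `D(A) ∩ D(A*)`. -/
def imPart (A : E →ₗ.[ℂ] E) : E →ₗ.[ℂ] E :=
  (1 / (2 * I)) • (A - A.adjoint)

/-- `Im A` is a bounded operator, with norm at most `M`: the operators `A` and `A*` have the same
domain and differ there by a bounded operator. -/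
def ImBoundedBy (A : E →ₗ.[ℂ] E) (M : ℝ) : Prop :=
  A.adjoint.domain = A.domain ∧
    ∀ u : (imPart A).domain, ‖imPart A u‖ ≤ M * ‖(u : E)‖

end Operators

/-- Condition (A): `F` is an analytic continuation, in the sense of Kato, of the family `H_ξ` from
`ℝⁿ` to the polystrip `S_a^n`, and its imaginary parts are bounded operators, uniformly on every
smaller polystrip. (Values of `F` off `S_a^n` play no role.) -/
structure ConditionA {n : ℕ} (H : L2Rn n →ₗ.[ℂ] L2Rn n) (a : ℝ)
    (F : (Fin n → ℂ) → L2Rn n →ₗ.[ℂ] L2Rn n) : Prop where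
  analytic : IsKatoAnalyticOn F (polystrip n a)
  extends_real : ∀ ξ : EuclideanSpace ℝ (Fin n), F (fun j => (ξ j : ℂ)) = conjugated H ξ
  im_bounded : ∀ a' < a, ∃ M : ℝ, ∀ ζ ∈ polystrip n a', ImBoundedBy (F ζ) M

/-- `c = sup_{|y| = μ} sup (Im H_{iy}) / μ`, for the continuation `ζ ↦ H_ζ = F ζ`. -/
def speed {n : ℕ} (F : (Fin n → ℂ) → L2Rn n →ₗ.[ℂ] L2Rn n) (μ : ℝ) : ℝ :=
  sSup {r | ∃ y : EuclideanSpace ℝ (Fin n), ‖y‖ = μ ∧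
    r = opSup (imPart (F fun j => I * (y j : ℂ))) / μ}

/-- `d_{XY} = inf {|x - y| : x ∈ X, y ∈ Y}`. -/
def setDist {n : ℕ} (X Y : Set (EuclideanSpace ℝ (Fin n))) : ℝ :=
  sInf {r | ∃ x ∈ X, ∃ y ∈ Y, r = dist x y}

end

/-!
The idea is the Combes-Thomas method. If `X` and `Y` are bounded, then for real `ξ` the operator
`1_X e^{-iHt} 1_Y` equals `1_X T_ξ⁻¹ e^{-iH_ξ t} T_ξ 1_Y`, and the right-hand side continues
analytically to `ξ = iy`. There `T_{iy}` is multiplication by `e^{y·x}`, while `e^{-iH_{iy}t}` has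
norm at most `e^{t sup Im H_{iy}} ≤ e^{μct}` for `t > 0` and `|y| = μ`. If `X` and `Y` lie in balls
of radius `ρ` around `p` and `q`, choosing `y` parallel to `p - q` gives the bound
`e^{μct - μ|p - q| + 2μρ}` (`ConditionA.norm_chi_mul_chi_le`).

The group `e^{-iH_ζ t}` itself is never constructed. By the exponential formula, `e^{-iHt}` is the
strong limit of `(-iλ (H - iλ)⁻¹)^k` with `λ = k/t` (`IsUnitaryGroupOf.tendsto_resolvent_pow`), and
the analytic continuation is carried out for these powers of resolvents
(`ConditionA.chi_resolvent_pow_chi`). The bound on the imaginary parts puts a half-plane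
`Im z > M`, uniform on a smaller polystrip, into the resolvent sets of all `H_ζ`
(`NumRangeImLe.exists_isResolvent`), and there the resolvents are analytic in `ζ`
(`IsKatoAnalyticOn.analyticAt_resolvent`). At `ζ = iy`, with `s = sup Im H_{iy}`, the estimate
`‖(H_{iy} - iλ)⁻¹‖ ≤ 1 / (λ - s)` bounds the `k`-th power by `(1 - st/k)^{-k}`, which tends to
`e^{st}`.

For arbitrary `X` and `Y`, space is cut into unit cubes. The block between two cubes is bounded by
`e^{μct - μ' d_{XY}}` times a constant times `e^{-(μ - μ')|k - l|}`, where `k, l ∈ ℤⁿ` index the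
cubes, since a block between cubes that do not both meet the sets vanishes; Schur's test
(`norm_le_of_norm_unitCube_block_le`) sums the blocks, and this is where the loss from `μ` to `μ'`
is spent. Negative times reduce to positive ones by taking adjoints.
-/

/-! ### Resolvents of operators with semibounded imaginary part -/

section SemiboundedImaginaryPart

variable {E : Type*} [NormedAddCommGroup E] [InnerProductSpace ℂ E]

/-- The numerical range of `A` lies in the half-plane `Im z ≤ s`. -/
def NumRangeImLe (A : E →ₗ.[ℂ] E) (s : ℝ) : Prop :=
  ∀ u : A.domain, (inner ℂ (u : E) (A u)).im ≤ s * ‖(u : E)‖ ^ 2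

theorem NumRangeImLe.norm_le {A : E →ₗ.[ℂ] E} {s : ℝ} (hA : NumRangeImLe A s) (z : ℂ)
    (u : A.domain) : (z.im - s) * ‖(u : E)‖ ≤ ‖A u - z • (u : E)‖ := by
  have h1 : (inner ℂ (u : E) (A u - z • (u : E))).im =
      (inner ℂ (u : E) (A u)).im - z.im * ‖(u : E)‖ ^ 2 := by
    rw [inner_sub_right, inner_smul_right, inner_self_eq_norm_sq_to_K]
    simp [← ofReal_pow]
  have h2 : -(inner ℂ (u : E) (A u - z • (u : E))).im ≤ ‖(u : E)‖ * ‖A u - z • (u : E)‖ :=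
    (neg_le_abs _).trans ((abs_im_le_norm _).trans (norm_inner_le_norm _ _))
  have h3 := hA u
  rcases (norm_nonneg (u : E)).eq_or_lt with h0 | h0
  · rw [← h0]; simp
  · have : ‖(u : E)‖ * ((z.im - s) * ‖(u : E)‖) ≤ ‖(u : E)‖ * ‖A u - z • (u : E)‖ := by
      nlinarith
    exact le_of_mul_le_mul_left this h0

theorem IsResolvent.unique {A : E →ₗ.[ℂ] E} {z : ℂ} {R S : E →L[ℂ] E} (hR : IsResolvent A z R)
    (hS : IsResolvent A z S) : R = S := by
  ext φ
  obtain ⟨h, e⟩ := hS.1 φ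
  have := hR.2 ⟨S φ, h⟩
  rwa [e] at this

theorem IsResolvent.norm_le {A : E →ₗ.[ℂ] E} {z : ℂ} {R : E →L[ℂ] E} (hR : IsResolvent A z R)
    {s : ℝ} (hA : NumRangeImLe A s) (hz : s < z.im) : ‖R‖ ≤ (z.im - s)⁻¹ := by
  have h0 : 0 < z.im - s := sub_pos.2 hz
  refine R.opNorm_le_bound (inv_nonneg.2 h0.le) fun φ => ?_
  obtain ⟨h, e⟩ := hR.1 φ
  have := hA.norm_le z ⟨R φ, h⟩
  rw [e] at this
  rwa [inv_mul_eq_div, le_div_iff₀ h0, mul_comm]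

/-- The first resolvent identity. -/
theorem IsResolvent.sub_eq {A : E →ₗ.[ℂ] E} {z₀ z : ℂ} {R₀ R : E →L[ℂ] E}
    (h₀ : IsResolvent A z₀ R₀) (h : IsResolvent A z R) : R - R₀ = (z - z₀) • (R₀ * R) := by
  ext φ
  obtain ⟨m, e⟩ := h.1 φ
  have h2 := h₀.2 ⟨R φ, m⟩
  rw [sub_eq_iff_eq_add.1 e] at h2
  simp only [map_sub, map_add, map_smul] at h2
  change R φ - R₀ φ = (z - z₀) • R₀ (R φ)
  rw [sub_smul]
  nth_rw 1 [← h2]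
  abel

/-- If `z₀` and `z` lie in the resolvent set of `A`, then
`1 - (z - z₀)(A - z₀)⁻¹ = (A - z)(A - z₀)⁻¹` is invertible, with inverse `1 + (z - z₀)(A - z)⁻¹`,
and this expresses the resolvent at `z` through the one at `z₀`. -/
theorem IsResolvent.eq_mul_inverse {A : E →ₗ.[ℂ] E} {z₀ z : ℂ} {R₀ R : E →L[ℂ] E}
    (h₀ : IsResolvent A z₀ R₀) (h : IsResolvent A z R) :
    IsUnit (1 - (z - z₀) • R₀) ∧ R = R₀ * Ring.inverse (1 - (z - z₀) • R₀) := by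
  have e1 : R - R₀ = (z - z₀) • (R₀ * R) := h₀.sub_eq h
  have e2 : R - R₀ = (z - z₀) • (R * R₀) := by
    rw [← neg_sub, h.sub_eq h₀, ← neg_smul, neg_sub]
  have l : (1 - (z - z₀) • R₀) * (1 + (z - z₀) • R) = 1 := by
    have : (1 - (z - z₀) • R₀) * (1 + (z - z₀) • R) =
        1 + (z - z₀) • ((R - R₀) - (z - z₀) • (R₀ * R)) := by
      simp only [sub_mul, mul_add, one_mul, mul_one, smul_sub, smul_mul_smul_comm, smul_smul]
      abel
    rw [this, e1]; simp
  have r : (1 + (z - z₀) • R) * (1 - (z - z₀) • R₀) = 1 := by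
    have : (1 + (z - z₀) • R) * (1 - (z - z₀) • R₀) =
        1 + (z - z₀) • ((R - R₀) - (z - z₀) • (R * R₀)) := by
      simp only [mul_sub, add_mul, one_mul, mul_one, smul_sub, smul_mul_smul_comm, smul_smul]
      abel
    rw [this, e2]; simp
  let w : (E →L[ℂ] E)ˣ := ⟨_, _, l, r⟩
  refine ⟨w.isUnit, ?_⟩
  have : Ring.inverse (1 - (z - z₀) • R₀) = 1 + (z - z₀) • R := Ring.inverse_unit w
  rw [this, mul_add, mul_one, mul_smul_comm, ← e1]
  abel

variable [CompleteSpace E]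

/-- A closed, densely defined operator which has the same domain as its adjoint and numerical
range in `Im z ≤ s` has every `z` with `Im z > s` in its resolvent set: `A - z` is bounded below,
so its range is closed, and a vector orthogonal to the range lies in `D(A*) = D(A)` and is
an eigenvector of `A*`, which the numerical range excludes. -/
theorem NumRangeImLe.exists_isResolvent {A : E →ₗ.[ℂ] E} {s : ℝ} (hA : NumRangeImLe A s)
    (hc : A.IsClosed) (had : A.adjoint.domain = A.domain)
    {z : ℂ} (hz : s < z.im) : ∃ R, IsResolvent A z R := by
  have h0 : 0 < z.im - s := sub_pos.2 hz
  have : CompleteSpace A.graph := IsClosed.completeSpace_coe (hs := hc)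
  let T : A.graph →L[ℂ] E :=
    (ContinuousLinearMap.snd ℂ E E - z • ContinuousLinearMap.fst ℂ E E).comp A.graph.subtypeL
  have hT : ∀ (u : A.domain), T ⟨(u, A u), A.mem_graph u⟩ = A u - z • (u : E) := fun u => rfl
  have hrep : ∀ p : A.graph, ∃ u : A.domain, p = ⟨(u, A u), A.mem_graph u⟩ := by
    rintro ⟨⟨x, y⟩, hp⟩
    obtain ⟨u, hu, hu'⟩ := (LinearPMap.mem_graph_iff A).1 hp
    exact ⟨u, by simp only at hu hu'; subst hu; subst hu'; rfl⟩
  have hlow : ∀ p : A.graph, ‖p‖ ≤ ((z.im - s)⁻¹ + 1 + ‖z‖ * (z.im - s)⁻¹) * ‖T p‖ := by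
    intro p
    obtain ⟨u, rfl⟩ := hrep p
    rw [hT]
    set v := A u - z • (u : E) with hv
    have h1 : ‖(u : E)‖ ≤ (z.im - s)⁻¹ * ‖v‖ := by
      rw [inv_mul_eq_div, le_div_iff₀ h0, mul_comm]
      exact hA.norm_le z u
    have h2 : ‖A u‖ ≤ ‖v‖ + ‖z‖ * ‖(u : E)‖ := by
      have : A u = v + z • (u : E) := by rw [hv]; abel
      rw [this, ← norm_smul]
      exact norm_add_le _ _
    have h3 : ‖z‖ * ‖(u : E)‖ ≤ ‖z‖ * ((z.im - s)⁻¹ * ‖v‖) := by gcongr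
    have h4 : 0 ≤ (z.im - s)⁻¹ * ‖v‖ := by positivity
    have h5 : 0 ≤ ‖z‖ * ((z.im - s)⁻¹ * ‖v‖) := by positivity
    have h6 := norm_nonneg v
    change max ‖(u : E)‖ ‖A u‖ ≤ _
    apply max_le <;> nlinarith
  have hK : 0 ≤ (z.im - s)⁻¹ + 1 + ‖z‖ * (z.im - s)⁻¹ := by positivity
  have hanti : AntilipschitzWith ⟨_, hK⟩ T :=
    T.antilipschitz_of_bound (K := ⟨_, hK⟩) hlow
  have hker : (T : A.graph →ₗ[ℂ] E).ker = ⊥ := LinearMap.ker_eq_bot.2 hanti.injective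
  have hcl : IsClosed (((T : A.graph →ₗ[ℂ] E).range : Submodule ℂ E) : Set E) := by
    have := hanti.isClosed_range T.uniformContinuous
    rwa [LinearMap.coe_range]
  have hran : (T : A.graph →ₗ[ℂ] E).range = ⊤ := by
    have : CompleteSpace (T : A.graph →ₗ[ℂ] E).range := IsClosed.completeSpace_coe (hs := hcl)
    rw [← Submodule.orthogonal_eq_bot_iff, Submodule.eq_bot_iff]
    intro φ hφ
    have hφ' : ∀ u : A.domain, inner ℂ ((starRingEnd ℂ z) • φ) (u : E) = inner ℂ φ (A u) := by
      intro u
      have : inner ℂ φ (A u - z • (u : E)) = 0 :=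
        (Submodule.mem_orthogonal' _ _).1 hφ _ ⟨⟨(u, A u), A.mem_graph u⟩, rfl⟩
      rw [inner_sub_right, sub_eq_zero, inner_smul_right] at this
      rw [inner_smul_left, conj_conj, this]
    have m : φ ∈ A.adjoint.domain := LinearPMap.mem_adjoint_domain_of_exists _ ⟨_, hφ'⟩
    have m' : φ ∈ A.domain := had ▸ m
    have h1 := hA ⟨φ, m'⟩
    have h2 := hφ' ⟨φ, m'⟩
    rw [← h2, inner_smul_left, conj_conj, inner_self_eq_norm_sq_to_K] at h1
    have h3 : z.im * ‖φ‖ ^ 2 ≤ s * ‖φ‖ ^ 2 := by simpa [← ofReal_pow] using h1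
    by_contra hne
    have : 0 < ‖φ‖ ^ 2 := by have := norm_pos_iff.2 hne; positivity
    nlinarith
  let e := ContinuousLinearEquiv.ofBijective T hker hran
  have he : ∀ p, e p = T p := fun p => rfl
  refine ⟨(ContinuousLinearMap.fst ℂ E E).comp
    (A.graph.subtypeL.comp (e.symm : E →L[ℂ] A.graph)), fun φ => ?_, fun u => ?_⟩
  · obtain ⟨u, hu⟩ := hrep (e.symm φ)
    have h1 : T (e.symm φ) = φ := by rw [← he]; exact e.apply_symm_apply φ
    rw [hu, hT] at h1
    have h2 : ((ContinuousLinearMap.fst ℂ E E).comp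
      (A.graph.subtypeL.comp (e.symm : E →L[ℂ] A.graph))) φ = u := by
      change ((e.symm φ : A.graph) : E × E).1 = u
      rw [hu]
    refine ⟨by rw [h2]; exact u.2, ?_⟩
    simp only [h2]
    exact h1
  · rw [← hT u, ← he]
    change ((e.symm (e _) : A.graph) : E × E).1 = u
    rw [e.symm_apply_apply]

theorem inner_imPart {A : E →ₗ.[ℂ] E} (hd : Dense (A.domain : Set E)) (u : (imPart A).domain)
    (hu : (u : E) ∈ A.domain) :
    inner ℂ (u : E) (imPart A u) = ((inner ℂ (u : E) (A ⟨u, hu⟩)).im : ℂ) := by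
  have hu2 : (u : E) ∈ A.adjoint.domain := u.2.2
  have e : imPart A u = (1 / (2 * I)) • (A ⟨u, hu⟩ - A.adjoint ⟨u, hu2⟩) := rfl
  have h : inner ℂ (u : E) (A.adjoint ⟨u, hu2⟩) =
      (starRingEnd ℂ) (inner ℂ (u : E) (A ⟨u, hu⟩)) := by
    rw [← inner_conj_symm]
    congr 1
    exact LinearPMap.adjoint_isFormalAdjoint hd ⟨u, hu2⟩ ⟨u, hu⟩
  rw [e, inner_smul_right, inner_sub_right, h, sub_conj]
  push_cast
  field_simp

theorem ImBoundedBy.numRangeImLe {A : E →ₗ.[ℂ] E} {M : ℝ} (h : ImBoundedBy A M)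
    (hd : Dense (A.domain : Set E)) : NumRangeImLe A M := by
  intro u
  let v : (imPart A).domain := ⟨u, u.2, by rw [h.1]; exact u.2⟩
  have h1 := inner_imPart hd v u.2
  have h2 : ‖(inner ℂ (v : E) (imPart A v))‖ ≤ ‖(v : E)‖ * (M * ‖(v : E)‖) :=
    (norm_inner_le_norm _ _).trans (by gcongr; exact h.2 v)
  rw [h1, norm_real, Real.norm_eq_abs] at h2
  have := (le_abs_self _).trans h2
  change _ ≤ M * ‖(v : E)‖ ^ 2
  calc _ ≤ _ := this
    _ = _ := by ring

/-- The set whose supremum is `sup Im A` is bounded above, so that this supremum is not a junk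
value. -/
theorem ImBoundedBy.mem_upperBounds {A : E →ₗ.[ℂ] E} {M : ℝ} (h : ImBoundedBy A M) :
    M ∈ upperBounds {r | ∃ u : (imPart A).domain, ‖(u : E)‖ = 1 ∧
      r = (inner ℂ (u : E) (imPart A u)).re} := by
  rintro r ⟨u, hu, rfl⟩
  calc _ ≤ ‖(inner ℂ (u : E) (imPart A u))‖ := re_le_norm _
    _ ≤ ‖(u : E)‖ * (M * ‖(u : E)‖) := (norm_inner_le_norm _ _).trans (by gcongr; exact h.2 u)
    _ = M := by rw [hu]; ring

theorem ImBoundedBy.opSup_le {A : E →ₗ.[ℂ] E} {M : ℝ} (h : ImBoundedBy A M) :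
    opSup (imPart A) ≤ max M 0 :=
  Real.sSup_le (fun _ hr => (h.mem_upperBounds hr).trans (le_max_left _ _)) (le_max_right _ _)

theorem ImBoundedBy.numRangeImLe_opSup {A : E →ₗ.[ℂ] E} {M : ℝ} (h : ImBoundedBy A M)
    (hd : Dense (A.domain : Set E)) : NumRangeImLe A (opSup (imPart A)) := by
  intro u
  rcases eq_or_ne (u : E) 0 with h0 | h0
  · simp [h0]
  have hn : 0 < ‖(u : E)‖ := norm_pos_iff.2 h0
  let w : A.domain := ((‖(u : E)‖⁻¹ : ℝ) : ℂ) • u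
  let v : (imPart A).domain := ⟨w, w.2, by rw [h.1]; exact w.2⟩
  have hv : ‖(v : E)‖ = 1 := by
    change ‖((‖(u : E)‖⁻¹ : ℝ) : ℂ) • (u : E)‖ = 1
    rw [norm_smul, norm_real, norm_inv, norm_norm, inv_mul_cancel₀ hn.ne']
  have h1 : (inner ℂ (v : E) (imPart A v)).re ≤ opSup (imPart A) :=
    le_csSup ⟨M, h.mem_upperBounds⟩ ⟨v, hv, rfl⟩
  rw [inner_imPart hd v w.2, ofReal_re] at h1
  have h2 : inner ℂ (v : E) (A ⟨v, w.2⟩) =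
      ((‖(u : E)‖⁻¹ ^ 2 : ℝ) : ℂ) * inner ℂ (u : E) (A u) := by
    change inner ℂ (((‖(u : E)‖⁻¹ : ℝ) : ℂ) • (u : E)) (A (((‖(u : E)‖⁻¹ : ℝ) : ℂ) • u)) = _
    rw [LinearPMap.map_smul, inner_smul_left, inner_smul_right, conj_ofReal]
    push_cast; ring
  rw [h2, im_ofReal_mul] at h1
  rw [inv_pow, inv_mul_eq_div, div_le_iff₀ (by positivity)] at h1
  exact h1

theorem IsSelfAdjoint.numRangeImLe_zero {H : E →ₗ.[ℂ] E} (hH : IsSelfAdjoint H) :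
    NumRangeImLe H 0 := by
  intro u
  have hH' : H.adjoint = H := hH
  have h2 : H.IsFormalAdjoint H := by
    have := LinearPMap.adjoint_isFormalAdjoint hH.dense_domain
    rwa [hH'] at this
  have h3 : (starRingEnd ℂ) (inner ℂ (u : E) (H u)) = inner ℂ (u : E) (H u) := by
    rw [inner_conj_symm]; exact h2 u u
  rw [conj_eq_iff_im.1 h3]; simp

theorem IsSelfAdjoint.exists_isResolvent {H : E →ₗ.[ℂ] E} (hH : IsSelfAdjoint H) {z : ℂ}
    (hz : 0 < z.im) : ∃ R, IsResolvent H z R :=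
  hH.numRangeImLe_zero.exists_isResolvent hH.isClosed
    (congrArg LinearPMap.domain (show H.adjoint = H from hH)) hz

/-- In a family analytic in the sense of Kato, the resolvents at any point `z` which is in the
resolvent set near `ζ₀` are analytic at `ζ₀`, not only those at the point `z₀` which the
definition provides. -/
theorem IsKatoAnalyticOn.analyticAt_resolvent {n : ℕ} {F : (Fin n → ℂ) → E →ₗ.[ℂ] E}
    {Ω : Set (Fin n → ℂ)} (hF : IsKatoAnalyticOn F Ω) {ζ₀ : Fin n → ℂ} (hζ₀ : ζ₀ ∈ Ω) {z : ℂ}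
    {R : (Fin n → ℂ) → E →L[ℂ] E} (hR : ∀ᶠ ζ in 𝓝 ζ₀, IsResolvent (F ζ) z (R ζ)) :
    AnalyticAt ℂ R ζ₀ := by
  obtain ⟨z₀, R₀, h₀, ha⟩ := hF.2 ζ₀ hζ₀
  obtain ⟨w, hw⟩ := (h₀.self_of_nhds.eq_mul_inverse hR.self_of_nhds).1
  have h1 : AnalyticAt ℂ (fun ζ => 1 - (z - z₀) • R₀ ζ) ζ₀ :=
    analyticAt_const.sub ((analyticAt_const (v := z - z₀)).fun_smul ha)
  have h2 : AnalyticAt ℂ (Ring.inverse : (E →L[ℂ] E) → _) (1 - (z - z₀) • R₀ ζ₀) :=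
    hw ▸ analyticAt_inverse (𝕜 := ℂ) w
  refine (ha.mul (h2.comp_of_eq h1 rfl)).congr ?_
  filter_upwards [h₀, hR] with ζ e₀ e
  exact (e₀.eq_mul_inverse e).2.symm

end SemiboundedImaginaryPart

/-! ### The exponential formula for unitary groups -/

section ExponentialFormula

variable {E : Type*} [NormedAddCommGroup E] [InnerProductSpace ℂ E]

/-- Contractions that converge pointwise to a contraction on a dense set converge everywhere. -/
theorem tendsto_apply_of_dense {ι : Type*} {l : Filter ι} {D : Set E} (hD : Dense D)
    {A : ι → E →L[ℂ] E} {B : E →L[ℂ] E} (hA : ∀ᶠ i in l, ‖A i‖ ≤ 1) (hB : ‖B‖ ≤ 1)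
    (h : ∀ g ∈ D, Tendsto (fun i => A i g) l (𝓝 (B g))) (f : E) :
    Tendsto (fun i => A i f) l (𝓝 (B f)) := by
  rw [Metric.tendsto_nhds]
  intro ε hε
  obtain ⟨g, hg, hfg⟩ := hD.exists_dist_lt f (show 0 < ε / 3 by positivity)
  filter_upwards [hA, Metric.tendsto_nhds.1 (h g hg) (ε / 3) (by positivity)] with i hi hi'
  have h1 : dist (A i f) (A i g) ≤ dist f g := by
    rw [dist_eq_norm, dist_eq_norm, ← map_sub]
    exact (A i).le_of_opNorm_le_of_le hi le_rfl |>.trans (by rw [one_mul])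
  have h2 : dist (B f) (B g) ≤ dist f g := by
    rw [dist_eq_norm, dist_eq_norm, ← map_sub]
    exact B.le_of_opNorm_le_of_le hB le_rfl |>.trans (by rw [one_mul])
  have h3 := dist_triangle4 (A i f) (A i g) (B g) (B f)
  rw [dist_comm (B g)] at h3
  linarith

theorem Commute.norm_pow_apply_sub_pow_apply_le {A B : E →L[ℂ] E} (h : Commute A B)
    (hA : ‖A‖ ≤ 1) (hB : ‖B‖ ≤ 1) (k : ℕ) (g : E) :
    ‖(A ^ k) g - (B ^ k) g‖ ≤ k * ‖A g - B g‖ := by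
  induction k with
  | zero => simp
  | succ k ih =>
    have hAk : ‖A ^ k‖ ≤ 1 := by
      rcases k.eq_zero_or_pos with rfl | hk
      · rw [pow_zero]; exact ContinuousLinearMap.norm_id_le
      · exact (norm_pow_le' A hk).trans (pow_le_one₀ (norm_nonneg _) hA)
    have e : A ^ (k + 1) - B ^ (k + 1) = A ^ k * (A - B) + B * (A ^ k - B ^ k) := by
      rw [mul_sub, mul_sub, (h.pow_left k).eq, pow_succ, pow_succ' B]
      abel
    have e' : (A ^ (k + 1)) g - (B ^ (k + 1)) g =
        (A ^ k) (A g - B g) + B ((A ^ k) g - (B ^ k) g) := by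
      simpa using congrArg (fun T : E →L[ℂ] E => T g) e
    rw [e']
    calc _ ≤ ‖(A ^ k) (A g - B g)‖ + ‖B ((A ^ k) g - (B ^ k) g)‖ := norm_add_le _ _
      _ ≤ 1 * ‖A g - B g‖ + 1 * (k * ‖A g - B g‖) :=
        add_le_add ((A ^ k).le_of_opNorm_le_of_le hAk le_rfl) (B.le_of_opNorm_le_of_le hB ih)
      _ = _ := by push_cast; ring

variable {H : E →ₗ.[ℂ] E} {U : ℝ → E →L[ℂ] E}

theorem IsUnitaryGroupOf.norm_le (hU : IsUnitaryGroupOf H U) (t : ℝ) : ‖U t‖ ≤ 1 :=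
  (U t).opNorm_le_bound zero_le_one fun ψ => by rw [hU.norm_apply, one_mul]

theorem IsUnitaryGroupOf.pow (hU : IsUnitaryGroupOf H U) (t : ℝ) (k : ℕ) :
    U t ^ k = U (k * t) := by
  induction k with
  | zero => simp [hU.zero]
  | succ k ih => rw [pow_succ, ih, ← hU.add]; congr 1; push_cast; ring

theorem IsUnitaryGroupOf.commute_resolvent (hU : IsUnitaryGroupOf H U) {z : ℂ} {R : E →L[ℂ] E}
    (hR : IsResolvent H z R) (t : ℝ) : Commute (U t) R := by
  ext φ
  obtain ⟨m, e⟩ := hR.1 φ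
  have hg : (U t (R φ), U t (H ⟨R φ, m⟩)) ∈ H.graph := by
    rw [hU.generator]
    have h1 := (hU.generator (R φ) _).1 (H.mem_graph ⟨R φ, m⟩)
    have h2 : HasDerivAt (fun s => U t (U s (R φ))) (U t (-I • H ⟨R φ, m⟩)) 0 :=
      ((U t).restrictScalars ℝ).hasFDerivAt.comp_hasDerivAt (0 : ℝ) h1
    rw [map_smul] at h2
    refine h2.congr_of_eventuallyEq (Eventually.of_forall fun s => ?_)
    change (U s * U t) (R φ) = (U t * U s) (R φ)
    rw [← hU.add, ← hU.add, add_comm]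
  obtain ⟨u, hu, hu'⟩ := (LinearPMap.mem_graph_iff H).1 hg
  have h3 := hR.2 u
  simp only at hu hu'
  rw [hu, hu', ← map_smul, ← map_sub, e] at h3
  exact h3.symm

variable [CompleteSpace E]

/-- `e^{-iHt}` is the strong limit of `(1 + i(t/k)H)^{-k}`. The implicit Euler step
`(1 + iλ⁻¹H)⁻¹` is written as `-iλ (H - iλ)⁻¹`. -/
theorem IsUnitaryGroupOf.tendsto_resolvent_pow (hU : IsUnitaryGroupOf H U)
    (hH : IsSelfAdjoint H) {R : ℂ → E →L[ℂ] E} (hR : ∀ z : ℂ, 0 < z.im → IsResolvent H z (R z))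
    {t : ℝ} (ht : 0 < t) (g : E) :
    Tendsto (fun k : ℕ => ((-(I * (k / t : ℝ)) • R (I * (k / t : ℝ))) ^ k) g) atTop
      (𝓝 (U t g)) := by
  set W : ℝ → E →L[ℂ] E := fun l => -(I * l) • R (I * l) with hW
  have him : ∀ l : ℝ, (I * l).im = l := fun l => by simp
  have hR' : ∀ l : ℝ, 0 < l → IsResolvent H (I * l) (R (I * l)) := fun l hl =>
    hR _ (by rwa [him])
  have hWn : ∀ l : ℝ, 0 < l → ‖W l‖ ≤ 1 := by
    intro l hl
    have h1 := (hR' l hl).norm_le hH.numRangeImLe_zero (by rwa [him])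
    rw [him, sub_zero] at h1
    calc ‖W l‖ = l * ‖R (I * l)‖ := by rw [hW]; simp [norm_smul, abs_of_pos hl]
      _ ≤ l * l⁻¹ := by gcongr
      _ = 1 := mul_inv_cancel₀ hl.ne'
  have hWD : ∀ l : ℝ, 0 < l → ∀ u : H.domain, (l : ℂ) • (W l u - u) = -I • W l (H u) := by
    intro l hl u
    have h1 := (hR' l hl).2 u
    rw [map_sub, map_smul] at h1
    have h2 : W l u - u = -R (I * l) (H u) := by
      rw [← sub_eq_zero]
      change -(I * (l : ℂ)) • R (I * l) (u : E) - (u : E) - -R (I * l) (H u) = 0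
      nth_rw 2 [← h1]
      rw [neg_smul]
      abel
    rw [h2]
    change _ = -I • (-(I * (l : ℂ)) • R (I * l) (H u))
    rw [smul_smul, smul_neg, ← neg_smul]
    congr 1
    linear_combination (-(l : ℂ)) * I_mul_I
  have hev : ∀ᶠ l : ℝ in atTop, 0 < l := eventually_gt_atTop 0
  have hW1 : ∀ φ, Tendsto (fun l => W l φ) atTop (𝓝 φ) := by
    intro φ
    refine tendsto_apply_of_dense (B := 1) hH.dense_domain (hev.mono hWn)
      ContinuousLinearMap.norm_id_le (fun g hg => ?_) φ
    rw [tendsto_iff_norm_sub_tendsto_zero]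
    have hz : Tendsto (fun l : ℝ => l⁻¹ * ‖H ⟨g, hg⟩‖) atTop (𝓝 0) := by
      simpa using tendsto_inv_atTop_zero.mul_const ‖H ⟨g, hg⟩‖
    refine squeeze_zero' (Eventually.of_forall fun _ => norm_nonneg _) ?_ hz
    filter_upwards [hev] with l hl
    have h1 : l * ‖W l g - g‖ ≤ ‖H ⟨g, hg⟩‖ := by
      have := congrArg norm (hWD l hl ⟨g, hg⟩)
      rw [norm_smul, norm_smul, norm_neg, norm_I, one_mul, norm_real, Real.norm_eq_abs,
        abs_of_pos hl] at this
      rw [this]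
      exact ((W l).le_of_opNorm_le (hWn l hl) _).trans (by rw [one_mul])
    rwa [inv_mul_eq_div, le_div_iff₀ hl, mul_comm]
  have hUW : ∀ u : H.domain,
      Tendsto (fun l : ℝ => l * ‖U l⁻¹ u - W l u‖) atTop (𝓝 0) := by
    intro u
    have h1 := ((hU.generator u _).1 (H.mem_graph u)).tendsto_slope_zero_right
    have h2 : Tendsto (fun l : ℝ => l⁻¹) atTop (𝓝[>] 0) := tendsto_inv_atTop_nhdsGT_zero
    have h3 : Tendsto (fun l : ℝ => (l : ℂ) • (U l⁻¹ u - u)) atTop (𝓝 (-I • H u)) := by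
      refine (h1.comp h2).congr fun l => ?_
      simp [hU.zero]
    have h4 : Tendsto (fun l : ℝ => (l : ℂ) • (W l u - u)) atTop (𝓝 (-I • H u)) := by
      refine ((hW1 (H u)).const_smul (-I)).congr' ?_
      filter_upwards [hev] with l hl using (hWD l hl u).symm
    have h5 := (h3.sub h4).norm
    rw [sub_self, norm_zero] at h5
    refine h5.congr' ?_
    filter_upwards [hev] with l hl
    rw [← smul_sub, sub_sub_sub_cancel_right, norm_smul, norm_real, Real.norm_eq_abs,
      abs_of_pos hl]
  have hk : Tendsto (fun k : ℕ => (k : ℝ) / t) atTop atTop :=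
    tendsto_natCast_atTop_atTop.atTop_div_const ht
  have hkpos : ∀ᶠ k : ℕ in atTop, 0 < (k : ℝ) / t := hk.eventually hev
  refine tendsto_apply_of_dense (A := fun k : ℕ => W (k / t) ^ k) hH.dense_domain
    ?_ (hU.norm_le t) (fun g hg => ?_) g
  · filter_upwards [hkpos, eventually_gt_atTop 0] with k hk hk0
    exact (norm_pow_le' _ hk0).trans (pow_le_one₀ (norm_nonneg _) (hWn _ hk))
  · rw [tendsto_iff_norm_sub_tendsto_zero]
    have hz : Tendsto (fun k : ℕ => t * ((k / t : ℝ) * ‖U (k / t : ℝ)⁻¹ g - W (k / t) g‖)) atTop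
        (𝓝 0) := by
      simpa using ((hUW ⟨g, hg⟩).comp hk).const_mul t
    refine squeeze_zero' (Eventually.of_forall fun _ => norm_nonneg _) ?_ hz
    filter_upwards [hkpos, eventually_gt_atTop 0] with k hk hk0
    have hk0' : (k : ℝ) ≠ 0 := by exact_mod_cast hk0.ne'
    have hc : Commute (U (k / t : ℝ)⁻¹) (W (k / t)) :=
      (hU.commute_resolvent (hR' _ hk) _).smul_right _
    have h1 := hc.norm_pow_apply_sub_pow_apply_le (hU.norm_le _) (hWn _ hk) k g
    have h2 : (k : ℝ) * ((k : ℝ) / t)⁻¹ = t := by field_simp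
    rw [hU.pow, h2, norm_sub_rev] at h1
    refine h1.trans (le_of_eq ?_)
    field_simp

end ExponentialFormula

/-! ### Multiplication operators -/

section MultiplicationOperators

variable {n : ℕ}

theorem coeFn_mulOp {m : EuclideanSpace ℝ (Fin n) → ℂ} (hm : MemLp m ∞ volume) (f : L2Rn n) :
    mulOp m hm f =ᵐ[volume] fun x => m x * f x := by
  have h := (ContinuousLinearMap.mul ℂ ℂ).coeFn_holder (r := 2) (hm.toLp m) f
  refine EventuallyEq.trans (show _ =ᵐ[volume] _ from h) ?_
  filter_upwards [hm.coeFn_toLp] with x hx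
  rw [hx]; rfl

theorem norm_mulOp_le {m : EuclideanSpace ℝ (Fin n) → ℂ} (hm : MemLp m ∞ volume) {C : ℝ}
    (hC : 0 ≤ C) (h : ∀ x, ‖m x‖ ≤ C) : ‖mulOp m hm‖ ≤ C := by
  refine ContinuousLinearMap.opNorm_le_bound _ hC fun f => ?_
  refine Lp.norm_le_mul_norm_of_ae_le_mul ?_
  filter_upwards [coeFn_mulOp hm f] with x hx
  rw [hx, norm_mul]
  gcongr
  exact h x

theorem mulOp_mul_mulOp {m₁ m₂ m : EuclideanSpace ℝ (Fin n) → ℂ} (h₁ : MemLp m₁ ∞ volume)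
    (h₂ : MemLp m₂ ∞ volume) (h : MemLp m ∞ volume) (e : ∀ x, m x = m₁ x * m₂ x) :
    mulOp m₁ h₁ * mulOp m₂ h₂ = mulOp m h := by
  ext1 f
  refine Lp.ext ?_
  filter_upwards [coeFn_mulOp h₁ (mulOp m₂ h₂ f), coeFn_mulOp h₂ f, coeFn_mulOp h f]
    with x e1 e2 e3
  rw [e3, e x, mul_assoc, ← e2]
  exact e1

theorem mulOp_add {m₁ m₂ m : EuclideanSpace ℝ (Fin n) → ℂ} (h₁ : MemLp m₁ ∞ volume)
    (h₂ : MemLp m₂ ∞ volume) (h : MemLp m ∞ volume) (e : ∀ x, m x = m₁ x + m₂ x) :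
    mulOp m h = mulOp m₁ h₁ + mulOp m₂ h₂ := by
  ext1 f
  refine Lp.ext ?_
  filter_upwards [coeFn_mulOp h₁ f, coeFn_mulOp h₂ f, coeFn_mulOp h f,
    Lp.coeFn_add (mulOp m₁ h₁ f) (mulOp m₂ h₂ f)] with x e1 e2 e3 e4
  rw [e3, e x, add_mul, ← e1, ← e2]
  exact e4.symm

theorem mulOp_smul {m₁ m : EuclideanSpace ℝ (Fin n) → ℂ} (c : ℂ) (h₁ : MemLp m₁ ∞ volume)
    (h : MemLp m ∞ volume) (e : ∀ x, m x = c * m₁ x) : mulOp m h = c • mulOp m₁ h₁ := by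
  ext1 f
  refine Lp.ext ?_
  filter_upwards [coeFn_mulOp h₁ f, coeFn_mulOp h f, Lp.coeFn_smul c (mulOp m₁ h₁ f)]
    with x e1 e3 e4
  rw [e3, e x, mul_assoc, ← e1]
  exact e4.symm

theorem mulOp_eq_one {m : EuclideanSpace ℝ (Fin n) → ℂ} (h : MemLp m ∞ volume)
    (e : ∀ x, m x = 1) : mulOp m h = 1 := by
  ext1 f
  refine Lp.ext ?_
  filter_upwards [coeFn_mulOp h f] with x e3
  rw [e3, e x, one_mul]; rfl

theorem phaseOp_mul_phaseOp_neg (ξ : EuclideanSpace ℝ (Fin n)) :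
    phaseOp ξ * phaseOp (-ξ) = 1 := by
  have h1 : MemLp (fun _ : EuclideanSpace ℝ (Fin n) => (1 : ℂ)) ∞ volume := memLp_top_const 1
  refine (mulOp_mul_mulOp _ _ h1 fun x => ?_).trans (mulOp_eq_one h1 fun _ => rfl)
  rw [← Complex.exp_add, inner_neg_left]
  simp

theorem phaseOp_neg_mul_phaseOp (ξ : EuclideanSpace ℝ (Fin n)) :
    phaseOp (-ξ) * phaseOp ξ = 1 := by
  simpa using phaseOp_mul_phaseOp_neg (-ξ)

theorem chi_mul_chi {X Y Z : Set (EuclideanSpace ℝ (Fin n))} (hX : MeasurableSet X)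
    (hY : MeasurableSet Y) (hZ : MeasurableSet Z) (h : Z = X ∩ Y) :
    chi X hX * chi Y hY = chi Z hZ := by
  refine mulOp_mul_mulOp _ _ _ fun x => ?_
  subst h
  by_cases h1 : x ∈ X <;> by_cases h2 : x ∈ Y <;> simp [h1, h2]

theorem chi_empty {X : Set (EuclideanSpace ℝ (Fin n))} (hX : MeasurableSet X) (h : X = ∅) :
    chi X hX = 0 := by
  subst h
  exact norm_le_zero_iff.1 (norm_mulOp_le _ le_rfl fun x => by simp)

theorem norm_chi_le {X : Set (EuclideanSpace ℝ (Fin n))} (hX : MeasurableSet X) :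
    ‖chi X hX‖ ≤ 1 :=
  norm_mulOp_le _ zero_le_one fun x => by
    by_cases h : x ∈ X <;> simp [h]

theorem inner_chi_left {X : Set (EuclideanSpace ℝ (Fin n))} (hX : MeasurableSet X)
    (f g : L2Rn n) : inner ℂ (chi X hX f) g = inner ℂ f (chi X hX g) := by
  rw [L2.inner_def, L2.inner_def]
  refine integral_congr_ae ?_
  filter_upwards [coeFn_mulOp (memLp_top_indicator_one hX) f,
    coeFn_mulOp (memLp_top_indicator_one hX) g] with x e1 e2
  change inner ℂ (mulOp _ (memLp_top_indicator_one hX) f x) (g x) =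
    inner ℂ (f x) (mulOp _ (memLp_top_indicator_one hX) g x)
  rw [e1, e2]
  by_cases h : x ∈ X <;> simp [h]

theorem adjoint_chi {X : Set (EuclideanSpace ℝ (Fin n))} (hX : MeasurableSet X) :
    ContinuousLinearMap.adjoint (chi X hX) = chi X hX :=
  ((ContinuousLinearMap.eq_adjoint_iff _ _).2 (inner_chi_left hX)).symm

theorem norm_sq_chi {X : Set (EuclideanSpace ℝ (Fin n))} (hX : MeasurableSet X) (f : L2Rn n) :
    ‖chi X hX f‖ ^ 2 = (inner ℂ f (chi X hX f)).re := by
  have e : chi X hX f = chi X hX (chi X hX f) :=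
    congrArg (fun T : L2Rn n →L[ℂ] L2Rn n => T f)
      (chi_mul_chi hX hX hX (Set.inter_self X).symm).symm
  rw [e, ← inner_chi_left, ← e, inner_self_eq_norm_sq_to_K]
  simp [← ofReal_pow]

/-! ### Truncated complex exponential weights -/

theorem exists_abs_inner_le {X : Set (EuclideanSpace ℝ (Fin n))} (hX : Bornology.IsBounded X)
    (y : EuclideanSpace ℝ (Fin n)) : ∃ K : ℝ, 0 < K ∧ ∀ x ∈ X, |inner ℝ y x| ≤ K := by
  obtain ⟨B, hB, h⟩ := hX.exists_pos_norm_le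
  refine ⟨‖y‖ * B + 1, by positivity, fun x hx => (abs_real_inner_le_norm y x).trans ?_⟩
  nlinarith [h x hx, norm_nonneg y]

theorem memLp_top_weight {X : Set (EuclideanSpace ℝ (Fin n))} (hX : MeasurableSet X)
    (hb : Bornology.IsBounded X) (y : EuclideanSpace ℝ (Fin n)) (w : ℂ) :
    MemLp (X.indicator fun x => Complex.exp (w * (inner ℝ y x : ℝ))) ∞ volume := by
  obtain ⟨K, -, hK⟩ := exists_abs_inner_le hb y
  have hm : AEStronglyMeasurable
      (X.indicator fun x => Complex.exp (w * (inner ℝ y x : ℝ))) volume :=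
    AEStronglyMeasurable.indicator (by fun_prop) hX
  refine memLp_top_of_bound hm (Real.exp (‖w‖ * K)) (Eventually.of_forall fun x => ?_)
  by_cases h : x ∈ X
  · rw [Set.indicator_of_mem h]
    refine (norm_exp_le_exp_norm _).trans (Real.exp_le_exp.2 ?_)
    rw [norm_mul, norm_real]
    gcongr
    exact hK x h
  · rw [Set.indicator_of_notMem h, norm_zero]
    positivity

/-- The operator of multiplication by `x ↦ 1_X(x) e^{w y·x}`, for a bounded set `X`. -/
noncomputable def weightOp {X : Set (EuclideanSpace ℝ (Fin n))} (hX : MeasurableSet X)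
    (hb : Bornology.IsBounded X) (y : EuclideanSpace ℝ (Fin n)) (w : ℂ) :
    L2Rn n →L[ℂ] L2Rn n :=
  mulOp (X.indicator fun x => Complex.exp (w * (inner ℝ y x : ℝ))) (memLp_top_weight hX hb y w)

theorem weightOp_differentiable {X : Set (EuclideanSpace ℝ (Fin n))} (hX : MeasurableSet X)
    (hb : Bornology.IsBounded X) (y : EuclideanSpace ℝ (Fin n)) :
    Differentiable ℂ (weightOp hX hb y) := by
  intro w
  obtain ⟨K, hK0, hK⟩ := exists_abs_inner_le hb y
  have hlin : MemLp (X.indicator fun x => ((inner ℝ y x : ℝ) : ℂ)) ∞ volume := by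
    have hm : AEStronglyMeasurable (X.indicator fun x => ((inner ℝ y x : ℝ) : ℂ)) volume :=
      AEStronglyMeasurable.indicator (by fun_prop) hX
    refine memLp_top_of_bound hm K (Eventually.of_forall fun x => ?_)
    by_cases h : x ∈ X
    · rw [Set.indicator_of_mem h, norm_real]; exact hK x h
    · rw [Set.indicator_of_notMem h, norm_zero]; exact hK0.le
  set D := mulOp _ hlin
  -- The derivative is found at `0` and moved to `w` by the functional equation.
  have hmul : ∀ h, weightOp hX hb y (w + h) = weightOp hX hb y w * weightOp hX hb y h := by
    intro h
    refine (mulOp_mul_mulOp _ _ _ fun x => ?_).symm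
    by_cases hx : x ∈ X
    · simp only [Set.indicator_of_mem hx]
      rw [← Complex.exp_add]; ring_nf
    · simp [hx]
  have h0 : HasDerivAt (weightOp hX hb y) D 0 := by
    rw [hasDerivAt_iff_isLittleO_nhds_zero]
    refine (Asymptotics.IsBigO.of_bound (K ^ 2) ?_).trans_isLittleO
      (Asymptotics.isLittleO_pow_id one_lt_two)
    filter_upwards [Metric.ball_mem_nhds (0 : ℂ) (inv_pos.2 hK0)] with h hh
    rw [mem_ball_zero_iff] at hh
    have hm : MemLp (X.indicator fun x => Complex.exp (h * (inner ℝ y x : ℝ)) - 1 -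
        h * (inner ℝ y x : ℝ)) ∞ volume := by
      have := ((memLp_top_weight hX hb y h).sub (memLp_top_indicator_one hX)).sub
        (hlin.const_mul h)
      refine this.ae_eq (Eventually.of_forall fun x => ?_)
      by_cases hx : x ∈ X <;> simp [hx]
    have hm1 : MemLp ((X.indicator fun x => Complex.exp (h * (inner ℝ y x : ℝ)) - 1)) ∞
        volume := by
      have := (memLp_top_weight hX hb y h).sub (memLp_top_indicator_one hX)
      refine this.ae_eq (Eventually.of_forall fun x => ?_)
      by_cases hx : x ∈ X <;> simp [hx]
    have e1 : weightOp hX hb y h = mulOp _ hm1 + weightOp hX hb y 0 :=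
      mulOp_add _ _ _ fun x => by by_cases hx : x ∈ X <;> simp [hx]
    have hlin' := hlin.const_mul h
    have e2 : mulOp _ hm1 = mulOp _ hm + h • D := by
      rw [← mulOp_smul h hlin hlin' fun x => rfl]
      exact mulOp_add _ _ _ fun x => by by_cases hx : x ∈ X <;> simp [hx]
    have e3 : weightOp hX hb y (0 + h) - weightOp hX hb y 0 - h • D = mulOp _ hm := by
      rw [zero_add, e1, e2]; abel
    rw [e3, norm_pow, ← mul_pow]
    refine norm_mulOp_le _ (by positivity) fun x => ?_
    by_cases hx : x ∈ X
    · rw [Set.indicator_of_mem hx]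
      have hle : ‖h * ((inner ℝ y x : ℝ) : ℂ)‖ ≤ K * ‖h‖ := by
        rw [norm_mul, norm_real, mul_comm]
        gcongr
        exact hK x hx
      have h1 : K * ‖h‖ ≤ 1 := by
        rw [← mul_inv_cancel₀ hK0.ne']
        gcongr
      exact (norm_exp_sub_one_sub_id_le (hle.trans h1)).trans (by gcongr)
    · rw [Set.indicator_of_notMem hx, norm_zero]; positivity
  have h1 : HasDerivAt (fun h => weightOp hX hb y w * weightOp hX hb y h)
      (weightOp hX hb y w * D) 0 := h0.const_mul _
  have h2 : HasDerivAt (fun v => weightOp hX hb y w * weightOp hX hb y (v - w))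
      (weightOp hX hb y w * D) w := by
    have := HasDerivAt.comp_sub_const w w (by simpa using h1)
    exact this
  refine (h2.congr_of_eventuallyEq (Eventually.of_forall fun v => ?_)).differentiableAt
  change _ = weightOp hX hb y w * weightOp hX hb y (v - w)
  rw [← hmul, add_sub_cancel]

theorem chi_mul_phaseOp {X : Set (EuclideanSpace ℝ (Fin n))} (hX : MeasurableSet X)
    (hb : Bornology.IsBounded X) (y : EuclideanSpace ℝ (Fin n)) (w : ℝ) :
    chi X hX * phaseOp (w • y) = weightOp hX hb y (-(I * w)) := by
  refine mulOp_mul_mulOp _ _ _ fun x => ?_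
  by_cases hx : x ∈ X
  · simp only [Set.indicator_of_mem hx, one_mul, real_inner_smul_left]
    push_cast; ring_nf
  · simp [hx]

theorem phaseOp_mul_chi {X : Set (EuclideanSpace ℝ (Fin n))} (hX : MeasurableSet X)
    (hb : Bornology.IsBounded X) (y : EuclideanSpace ℝ (Fin n)) (w : ℝ) :
    phaseOp (w • y) * chi X hX = weightOp hX hb y (-(I * w)) := by
  rw [← chi_mul_phaseOp hX hb]
  rw [chi, phaseOp, mulOp_mul_mulOp _ _ (memLp_top_weight hX hb y (-(I * w))) fun x => ?_,
    mulOp_mul_mulOp _ _ (memLp_top_weight hX hb y (-(I * w))) fun x => ?_]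
  all_goals
    by_cases hx : x ∈ X
    · simp only [Set.indicator_of_mem hx, one_mul, mul_one, real_inner_smul_left]
      push_cast; ring_nf
    · simp [hx]

theorem norm_weightOp_le {X : Set (EuclideanSpace ℝ (Fin n))} (hX : MeasurableSet X)
    (hb : Bornology.IsBounded X) (y : EuclideanSpace ℝ (Fin n)) (w : ℝ) {K : ℝ}
    (h : ∀ x ∈ X, w * inner ℝ y x ≤ K) : ‖weightOp hX hb y w‖ ≤ Real.exp K := by
  refine norm_mulOp_le _ (Real.exp_pos _).le fun x => ?_
  by_cases hx : x ∈ X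
  · rw [Set.indicator_of_mem hx, norm_exp]
    refine Real.exp_le_exp.2 ?_
    simpa using h x hx
  · rw [Set.indicator_of_notMem hx, norm_zero]; positivity

end MultiplicationOperators

/-! ### The bound between two balls -/

section BallBound

variable {n : ℕ} {H : L2Rn n →ₗ.[ℂ] L2Rn n}

theorem IsResolvent.conjugated {z : ℂ} {R : L2Rn n →L[ℂ] L2Rn n} (hR : IsResolvent H z R)
    (ξ : EuclideanSpace ℝ (Fin n)) :
    IsResolvent (conjugated H ξ) z (phaseOp ξ * R * phaseOp (-ξ)) := by
  have h1 : ∀ φ, phaseOp ξ (phaseOp (-ξ) φ) = φ := fun φ =>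
    congrArg (fun T : L2Rn n →L[ℂ] L2Rn n => T φ) (phaseOp_mul_phaseOp_neg ξ)
  have h2 : ∀ φ, phaseOp (-ξ) (phaseOp ξ φ) = φ := fun φ =>
    congrArg (fun T : L2Rn n →L[ℂ] L2Rn n => T φ) (phaseOp_neg_mul_phaseOp ξ)
  refine ⟨fun φ => ?_, fun ψ => ?_⟩
  · obtain ⟨m, e⟩ := hR.1 (phaseOp (-ξ) φ)
    have e2 : phaseOp (-ξ) ((phaseOp ξ * R * phaseOp (-ξ)) φ) = R (phaseOp (-ξ) φ) := h2 _
    refine ⟨?_, ?_⟩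
    · change phaseOp (-ξ) ((phaseOp ξ * R * phaseOp (-ξ)) φ) ∈ H.domain
      rwa [e2]
    · change phaseOp ξ (H ⟨phaseOp (-ξ) ((phaseOp ξ * R * phaseOp (-ξ)) φ), _⟩) -
        z • phaseOp ξ (R (phaseOp (-ξ) φ)) = φ
      simp only [e2]
      rw [← map_smul, ← map_sub, e, h1]
  · have e := hR.2 ⟨phaseOp (-ξ) ψ, ψ.2⟩
    change phaseOp ξ (R (phaseOp (-ξ) (phaseOp ξ (H ⟨phaseOp (-ξ) ψ, ψ.2⟩) - z • (ψ : L2Rn n)))) = ψ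
    rw [map_sub, h2, map_smul, e, h1]

/-- The identity that replaces `e^{-iHt} = T⁻¹ e^{-iH_ζ t} T` at `ζ = iy`. The right-hand side, with
`T_{wy}` for `T_{iy}`, is analytic for `w` in a strip around the real axis and independent of `w`
for real `w`, where it is the conjugation by a unitary. -/
theorem ConditionA.chi_resolvent_pow_chi {a : ℝ} {F : (Fin n → ℂ) → L2Rn n →ₗ.[ℂ] L2Rn n}
    (hF : ConditionA H a F) {a' μ : ℝ} (hμ : 0 < μ) (hμa : μ < a') (haa : a' < a) {z : ℂ}
    {R : L2Rn n →L[ℂ] L2Rn n} (hR : IsResolvent H z R)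
    {S : (Fin n → ℂ) → L2Rn n →L[ℂ] L2Rn n}
    (hS : ∀ ζ ∈ polystrip n a', IsResolvent (F ζ) z (S ζ))
    {X Y : Set (EuclideanSpace ℝ (Fin n))} (hX : MeasurableSet X) (hY : MeasurableSet Y)
    (hXb : Bornology.IsBounded X) (hYb : Bornology.IsBounded Y)
    {y : EuclideanSpace ℝ (Fin n)} (hy : ‖y‖ = μ) (k : ℕ) :
    chi X hX * R ^ k * chi Y hY =
      weightOp hX hXb y (-1) * S (fun j => I * (y j : ℂ)) ^ k * weightOp hY hYb y 1 := by
  set v : Fin n → ℂ := fun j => (y j : ℂ)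
  set Ω : Set ℂ := {w | |w.im| < a' / μ} with hΩ
  have hΩ' : Ω = im ⁻¹' Metric.ball (0 : ℝ) (a' / μ) := by
    ext w; simp [hΩ]
  have hΩc : IsPreconnected Ω := by
    rw [hΩ']
    exact ((convex_ball (0 : ℝ) _).is_linear_preimage imLm.isLinear).isPreconnected
  have hmem : ∀ w ∈ Ω, w • v ∈ polystrip n a' := by
    intro w hw j
    have h1 : ((w • v) j).im = w.im * y j := by simp [v]
    have h2 : |y j| ≤ μ := hy ▸ PiLp.norm_apply_le y j
    rw [h1, abs_mul]
    calc |w.im| * |y j| ≤ |w.im| * μ := by gcongr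
      _ < a' / μ * μ := mul_lt_mul_of_pos_right hw hμ
      _ = a' := div_mul_cancel₀ _ hμ.ne'
  have hopen : IsOpen (polystrip n a') := by
    have : polystrip n a' = ⋂ j, {ζ : Fin n → ℂ | |(ζ j).im| < a'} := by
      ext; simp [polystrip]
    rw [this]
    exact isOpen_iInter_of_finite fun j => isOpen_lt (by fun_prop) continuous_const
  have hSan : AnalyticOnNhd ℂ (fun w : ℂ => S (w • v)) Ω := by
    intro w hw
    have h1 : w • v ∈ polystrip n a := fun j => (hmem w hw j).trans haa
    have h2 : AnalyticAt ℂ S (w • v) := hF.analytic.analyticAt_resolvent h1 <| by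
      filter_upwards [hopen.mem_nhds (hmem w hw)] with ζ hζ using hS ζ hζ
    exact h2.comp_of_eq ((ContinuousLinearMap.toSpanSingleton ℂ v).analyticAt w) rfl
  have hWan : ∀ {Z : Set (EuclideanSpace ℝ (Fin n))} (hZ : MeasurableSet Z)
      (hZb : Bornology.IsBounded Z) (c : ℂ),
      AnalyticOnNhd ℂ (fun w : ℂ => weightOp hZ hZb y (c * w)) Ω := by
    intro Z hZ hZb c w _
    have hd : Differentiable ℂ fun w : ℂ => weightOp hZ hZb y (c * w) :=
      (weightOp_differentiable hZ hZb y).comp (differentiable_id.const_mul c)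
    exact hd.analyticAt w
  have hG : AnalyticOnNhd ℂ (fun w : ℂ => weightOp hX hXb y (I * w) * S (w • v) ^ k *
      weightOp hY hYb y (-I * w)) Ω :=
    ((hWan hX hXb I).mul (hSan.pow k)).mul (hWan hY hYb (-I))
  have hreal : ∀ w : ℝ, weightOp hX hXb y (I * w) * S ((w : ℂ) • v) ^ k *
      weightOp hY hYb y (-I * w) = chi X hX * R ^ k * chi Y hY := by
    intro w
    have hw : (w : ℂ) ∈ Ω := by
      simp only [hΩ, Set.mem_ofPred_eq, ofReal_im, abs_zero]
      exact div_pos (hμ.trans hμa) hμ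
    have e1 : (w : ℂ) • v = fun j => (((w • y : EuclideanSpace ℝ (Fin n)) j : ℝ) : ℂ) := by
      ext j; simp [v]
    have e2 : S ((w : ℂ) • v) = phaseOp (w • y) * R * phaseOp (-(w • y)) := by
      have h1 := hS _ (hmem _ hw)
      have h2 := hR.conjugated (w • y)
      rw [← hF.extends_real, ← e1] at h2
      exact h1.unique h2
    let u : (L2Rn n →L[ℂ] L2Rn n)ˣ :=
      ⟨phaseOp (w • y), phaseOp (-(w • y)), phaseOp_mul_phaseOp_neg _, phaseOp_neg_mul_phaseOp _⟩
    have e3 : S ((w : ℂ) • v) ^ k = phaseOp (w • y) * R ^ k * phaseOp (-(w • y)) := by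
      rw [e2]; exact Units.conj_pow u R k
    have e4 : weightOp hX hXb y (I * w) = chi X hX * phaseOp (-(w • y)) := by
      rw [← neg_smul, chi_mul_phaseOp hX hXb]; simp
    have e5 : weightOp hY hYb y (-I * w) = phaseOp (w • y) * chi Y hY := by
      rw [phaseOp_mul_chi hY hYb, neg_mul]
    rw [e3, e4, e5]
    calc _ = chi X hX * (phaseOp (-(w • y)) * phaseOp (w • y)) * R ^ k *
          (phaseOp (-(w • y)) * phaseOp (w • y)) * chi Y hY := by simp only [mul_assoc]
      _ = _ := by rw [phaseOp_neg_mul_phaseOp, mul_one, mul_one]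
  have hfreq : ∃ᶠ w : ℂ in 𝓝[≠] 0, weightOp hX hXb y (I * w) * S (w • v) ^ k *
      weightOp hY hYb y (-I * w) = chi X hX * R ^ k * chi Y hY := by
    have ht : Tendsto (fun w : ℝ => (w : ℂ)) (𝓝[≠] 0) (𝓝[≠] 0) := by
      refine tendsto_nhdsWithin_iff.2 ⟨?_, ?_⟩
      · exact (continuous_ofReal.tendsto' 0 0 ofReal_zero).mono_left nhdsWithin_le_nhds
      · filter_upwards [self_mem_nhdsWithin] with w hw
        simpa using hw
    exact ht.frequently (Eventually.of_forall hreal).frequently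
  have h0 : (0 : ℂ) ∈ Ω := by
    simp only [hΩ, Set.mem_ofPred_eq, zero_im, abs_zero]
    exact div_pos (hμ.trans hμa) hμ
  have hI : I ∈ Ω := by
    simp only [hΩ, Set.mem_ofPred_eq, I_im, abs_one]
    rwa [one_lt_div hμ]
  have := hG.eqOn_of_preconnected_of_frequently_eq analyticOnNhd_const hΩc h0 hfreq hI
  simp only [neg_mul, I_mul_I, neg_neg] at this
  exact this.symm

theorem exists_norm_eq_inner_eq (hn : 0 < n) {μ : ℝ} (hμ : 0 ≤ μ)
    (v : EuclideanSpace ℝ (Fin n)) :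
    ∃ y : EuclideanSpace ℝ (Fin n), ‖y‖ = μ ∧ inner ℝ y v = μ * ‖v‖ := by
  rcases eq_or_ne v 0 with rfl | hv
  · exact ⟨EuclideanSpace.single ⟨0, hn⟩ μ, by simp [abs_of_nonneg hμ], by simp⟩
  · have h0 : ‖v‖ ≠ 0 := norm_ne_zero_iff.2 hv
    refine ⟨(μ / ‖v‖) • v, ?_, ?_⟩
    · rw [norm_smul, Real.norm_eq_abs, abs_of_nonneg (by positivity), div_mul_cancel₀ _ h0]
    · rw [real_inner_smul_left, real_inner_self_eq_norm_sq]
      field_simp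

theorem ConditionA.opSup_le_mul_speed {a : ℝ} {F : (Fin n → ℂ) → L2Rn n →ₗ.[ℂ] L2Rn n}
    (hF : ConditionA H a F) {μ : ℝ} (hμ : 0 < μ) (hμa : μ < a) {y : EuclideanSpace ℝ (Fin n)}
    (hy : ‖y‖ = μ) : opSup (imPart (F fun j => I * (y j : ℂ))) ≤ μ * speed F μ := by
  obtain ⟨a', h1, h2⟩ := exists_between hμa
  obtain ⟨M, hM⟩ := hF.im_bounded a' h2
  have hmem : ∀ x : EuclideanSpace ℝ (Fin n), ‖x‖ = μ →
      (fun j => I * (x j : ℂ)) ∈ polystrip n a' := by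
    intro x hx j
    have : |x j| ≤ μ := hx ▸ PiLp.norm_apply_le x j
    simpa using this.trans_lt h1
  rw [mul_comm, ← div_le_iff₀ hμ]
  refine le_csSup ⟨max M 0 / μ, ?_⟩ ⟨y, hy, rfl⟩
  rintro r ⟨x, hx, rfl⟩
  gcongr
  exact (hM _ (hmem x hx)).opSup_le

/-- The light cone estimate between subsets of two balls of radius `ρ`. -/
theorem ConditionA.norm_chi_mul_chi_le {a : ℝ} {F : (Fin n → ℂ) → L2Rn n →ₗ.[ℂ] L2Rn n}
    (hF : ConditionA H a F) (hH : IsSelfAdjoint H) {U : ℝ → L2Rn n →L[ℂ] L2Rn n}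
    (hU : IsUnitaryGroupOf H U) (hn : 0 < n) {μ : ℝ} (hμ : 0 < μ) (hμa : μ < a)
    {X Y : Set (EuclideanSpace ℝ (Fin n))} (hX : MeasurableSet X) (hY : MeasurableSet Y)
    {p q : EuclideanSpace ℝ (Fin n)} {ρ : ℝ} (hXp : X ⊆ Metric.closedBall p ρ)
    (hYq : Y ⊆ Metric.closedBall q ρ) {t : ℝ} (ht : 0 < t) :
    ‖chi X hX * U t * chi Y hY‖ ≤
      Real.exp (μ * speed F μ * t - μ * dist p q + 2 * μ * ρ) := by
  obtain ⟨y, hy, hyi⟩ := exists_norm_eq_inner_eq hn hμ.le (p - q)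
  obtain ⟨a', h1, h2⟩ := exists_between hμa
  obtain ⟨M, hM⟩ := hF.im_bounded a' h2
  have hXb := Metric.isBounded_closedBall.subset hXp
  have hYb := Metric.isBounded_closedBall.subset hYq
  set s := μ * speed F μ with hs
  set ζ : Fin n → ℂ := fun j => I * (y j : ℂ) with hζ
  have hζm : ζ ∈ polystrip n a' := by
    intro j
    have : |y j| ≤ μ := hy ▸ PiLp.norm_apply_le y j
    simpa [hζ] using this.trans_lt h1
  have hdense : ∀ η ∈ polystrip n a', Dense ((F η).domain : Set (L2Rn n)) := fun η hη =>
    (hF.analytic.1 η fun j => (hη j).trans h2).2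
  have hnum : NumRangeImLe (F ζ) s := fun u =>
    ((hM ζ hζm).numRangeImLe_opSup (hdense ζ hζm) u).trans
      (by gcongr; exact hF.opSup_le_mul_speed hμ hμa hy)
  choose! R hR using fun (z : ℂ) (hz : 0 < z.im) => hH.exists_isResolvent hz
  have hSex : ∀ z : ℂ, M < z.im → ∀ η ∈ polystrip n a', ∃ S, IsResolvent (F η) z S :=
    fun z hz η hη => ((hM η hη).numRangeImLe (hdense η hη)).exists_isResolvent
      (hF.analytic.1 η fun j => (hη j).trans h2).1 (hM η hη).1 hz
  choose! S hS using hSex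
  have hwX : ‖weightOp hX hXb y (-1)‖ ≤ Real.exp (-inner ℝ y p + μ * ρ) := by
    have := norm_weightOp_le hX hXb y (-1) (K := -inner ℝ y p + μ * ρ) fun x hx => by
      have h3 := (abs_le.1 (abs_real_inner_le_norm y (x - p))).1
      have h4 : ‖x - p‖ ≤ ρ := by rw [← dist_eq_norm]; exact hXp hx
      rw [hy, inner_sub_right] at h3
      nlinarith
    simpa using this
  have hwY : ‖weightOp hY hYb y 1‖ ≤ Real.exp (inner ℝ y q + μ * ρ) := by
    have := norm_weightOp_le hY hYb y 1 (K := inner ℝ y q + μ * ρ) fun x hx => by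
      have h3 := (abs_le.1 (abs_real_inner_le_norm y (x - q))).2
      have h4 : ‖x - q‖ ≤ ρ := by rw [← dist_eq_norm]; exact hYq hx
      rw [hy, inner_sub_right] at h3
      nlinarith
    simpa using this
  have hk : Tendsto (fun k : ℕ => (k : ℝ) / t) atTop atTop :=
    tendsto_natCast_atTop_atTop.atTop_div_const ht
  have him : ∀ l : ℝ, (I * (l : ℂ)).im = l := fun l => by simp
  set K := Real.exp (-inner ℝ y p + μ * ρ) * Real.exp (inner ℝ y q + μ * ρ) with hK
  refine ContinuousLinearMap.opNorm_le_bound _ (Real.exp_pos _).le fun g => ?_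
  have hlim : Tendsto (fun k : ℕ => ‖chi X hX
      (((-(I * (k / t : ℝ)) • R (I * (k / t : ℝ))) ^ k) (chi Y hY g))‖) atTop
      (𝓝 ‖chi X hX (U t (chi Y hY g))‖) :=
    (((chi X hX).continuous.tendsto _).comp (hU.tendsto_resolvent_pow hH hR ht _)).norm
  have hlim2 : Tendsto (fun k : ℕ => K * ((1 + -(s * t) / k) ^ k)⁻¹ * ‖g‖) atTop
      (𝓝 (K * (Real.exp (-(s * t)))⁻¹ * ‖g‖)) :=
    (((Real.tendsto_one_add_div_pow_exp _).inv₀ (Real.exp_ne_zero _)).const_mul K).mul_const _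
  have hfin : K * (Real.exp (-(s * t)))⁻¹ =
      Real.exp (s * t - μ * dist p q + 2 * μ * ρ) := by
    rw [hK, ← Real.exp_neg, ← Real.exp_add, ← Real.exp_add, dist_eq_norm, ← hyi,
      inner_sub_right]
    congr 1; ring
  rw [← hfin]
  refine le_of_tendsto_of_tendsto hlim hlim2 ?_
  filter_upwards [hk.eventually (eventually_gt_atTop 0), hk.eventually (eventually_gt_atTop M),
    hk.eventually (eventually_gt_atTop s), eventually_gt_atTop 0] with k k0 kM ks hk0
  set l := (k : ℝ) / t with hl
  have e1 := hF.chi_resolvent_pow_chi hμ h1 h2 (hR (I * l) (by rwa [him]))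
    (hS (I * l) (by rwa [him])) hX hY hXb hYb hy k
  have e2 : ‖(-(I * (l : ℂ))) • S (I * l) ζ‖ ≤ (1 + -(s * t) / k)⁻¹ := by
    have h3 := (hS (I * l) (by rwa [him]) ζ hζm).norm_le hnum (by rwa [him])
    rw [him] at h3
    have h4 : ‖-(I * (l : ℂ))‖ = l := by simp [abs_of_pos k0]
    rw [norm_smul, h4]
    calc l * _ ≤ l * (l - s)⁻¹ := by gcongr
      _ = (1 + -(s * t) / k)⁻¹ := by
        have h5 : (l - s) = l * (1 + -(s * t) / k) := by
          have : (k : ℝ) ≠ 0 := by exact_mod_cast hk0.ne'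
          rw [hl]; field_simp; ring
        rw [h5, mul_inv, ← mul_assoc, mul_inv_cancel₀ k0.ne', one_mul]
  have e3 : chi X hX * ((-(I * (l : ℂ))) • R (I * l)) ^ k * chi Y hY =
      weightOp hX hXb y (-1) * ((-(I * (l : ℂ))) • S (I * l) ζ) ^ k * weightOp hY hYb y 1 := by
    rw [smul_pow, smul_pow, mul_smul_comm, smul_mul_assoc, e1, mul_smul_comm, smul_mul_assoc]
  have e4 : ‖chi X hX * ((-(I * (l : ℂ))) • R (I * l)) ^ k * chi Y hY‖ ≤
      K * ((1 + -(s * t) / k) ^ k)⁻¹ := by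
    have e5 : 0 ≤ (1 + -(s * t) / k)⁻¹ := (norm_nonneg _).trans e2
    rw [e3, hK, ← inv_pow]
    calc _ ≤ ‖weightOp hX hXb y (-1)‖ * ‖(-(I * (l : ℂ))) • S (I * l) ζ‖ ^ k *
          ‖weightOp hY hYb y 1‖ :=
        (norm_mul_le _ _).trans (mul_le_mul_of_nonneg_right ((norm_mul_le _ _).trans
          (mul_le_mul_of_nonneg_left (norm_pow_le' _ hk0) (norm_nonneg _))) (norm_nonneg _))
      _ ≤ Real.exp (-inner ℝ y p + μ * ρ) * (1 + -(s * t) / k)⁻¹ ^ k *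
          Real.exp (inner ℝ y q + μ * ρ) := by gcongr
      _ = _ := by ring
  exact ContinuousLinearMap.le_of_opNorm_le _ e4 g

end BallBound

/-! ### Unit cubes and lattice sums -/

section Cubes

variable {n : ℕ}

/-- The half-open unit cube with lower corner `k ∈ ℤⁿ`. -/
def unitCube (k : Fin n → ℤ) : Set (EuclideanSpace ℝ (Fin n)) :=
  {x | ∀ i, ⌊x i⌋ = k i}

/-- A point of `ℤⁿ`, viewed in `ℝⁿ` with its Euclidean norm. -/
noncomputable def latticePoint (k : Fin n → ℤ) : EuclideanSpace ℝ (Fin n) :=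
  WithLp.toLp 2 fun i => (k i : ℝ)

/-- An upper bound for `∑_{k ∈ ℤⁿ} e^{-δ|k|}`: a product of one-dimensional sums, which dominates
by `n |k| ≥ ∑ᵢ |kᵢ|`. -/
noncomputable def latticeSum (δ : ℝ) (n : ℕ) : ℝ :=
  (1 + ∑' j : ℤ, Real.exp (-(δ / n) * |(j : ℝ)|)) ^ n

theorem latticeSum_pos (δ : ℝ) (n : ℕ) : 0 < latticeSum δ n := by
  have : 0 ≤ ∑' j : ℤ, Real.exp (-(δ / n) * |(j : ℝ)|) := tsum_nonneg fun _ => (Real.exp_pos _).le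
  unfold latticeSum
  positivity

theorem summable_exp_neg_mul_abs_int {δ : ℝ} (hδ : 0 < δ) :
    Summable fun j : ℤ => Real.exp (-δ * |(j : ℝ)|) := by
  have h : Summable fun j : ℕ => Real.exp (-δ * j) := by
    refine (summable_geometric_of_lt_one (Real.exp_pos (-δ)).le
      (by rw [← Real.exp_zero]; exact Real.exp_lt_exp.2 (by linarith))).congr fun j => ?_
    rw [← Real.exp_nat_mul, mul_comm]
  exact Summable.of_nat_of_neg (by simpa using h) (by simpa using h)

theorem sum_exp_neg_mul_norm_latticePoint_le (hn : 0 < n) {δ : ℝ} (hδ : 0 < δ)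
    (S : Finset (Fin n → ℤ)) :
    ∑ k ∈ S, Real.exp (-δ * ‖latticePoint k‖) ≤ latticeSum δ n := by
  have hn' : (0 : ℝ) < n := by exact_mod_cast hn
  let B : Fin n → Finset ℤ := fun i => S.image fun k => k i
  have hSB : S ⊆ Fintype.piFinset B := fun k hk =>
    Fintype.mem_piFinset.2 fun i => Finset.mem_image_of_mem _ hk
  have h1 : ∀ k : Fin n → ℤ, Real.exp (-δ * ‖latticePoint k‖) ≤
      ∏ i, Real.exp (-(δ / n) * |(k i : ℝ)|) := by
    intro k
    rw [← Real.exp_sum, ← Finset.mul_sum]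
    refine Real.exp_le_exp.2 ?_
    have h2 : ∑ i, |(k i : ℝ)| ≤ n * ‖latticePoint k‖ := by
      have := Finset.sum_le_card_nsmul Finset.univ (fun i => |(k i : ℝ)|) ‖latticePoint k‖
        fun i _ => PiLp.norm_apply_le (latticePoint k) i
      simpa using this
    have h3 : δ / n * ∑ i, |(k i : ℝ)| ≤ δ / n * (n * ‖latticePoint k‖) := by gcongr
    have h4 : δ / n * (n * ‖latticePoint k‖) = δ * ‖latticePoint k‖ := by field_simp
    linarith
  calc _ ≤ ∑ k ∈ S, ∏ i, Real.exp (-(δ / n) * |(k i : ℝ)|) := Finset.sum_le_sum fun k _ => h1 k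
    _ ≤ ∑ k ∈ Fintype.piFinset B, ∏ i, Real.exp (-(δ / n) * |(k i : ℝ)|) :=
      Finset.sum_le_sum_of_subset_of_nonneg hSB fun _ _ _ => by positivity
    _ = ∏ i, ∑ j ∈ B i, Real.exp (-(δ / n) * |(j : ℝ)|) :=
      (Finset.prod_univ_sum B fun _ (j : ℤ) => Real.exp (-(δ / n) * |(j : ℝ)|)).symm
    _ ≤ ∏ _i : Fin n, (1 + ∑' j : ℤ, Real.exp (-(δ / n) * |(j : ℝ)|)) := by
      refine Finset.prod_le_prod (fun i _ => by positivity) fun i _ => ?_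
      have := (summable_exp_neg_mul_abs_int (div_pos hδ hn')).sum_le_tsum (B i)
        fun _ _ => (Real.exp_pos _).le
      linarith
    _ = latticeSum δ n := by simp [latticeSum]

theorem sum_exp_neg_mul_dist_le (hn : 0 < n) {δ : ℝ} (hδ : 0 < δ) (S : Finset (Fin n → ℤ))
    (l : Fin n → ℤ) :
    ∑ k ∈ S, Real.exp (-δ * dist (latticePoint k) (latticePoint l)) ≤ latticeSum δ n := by
  have e : ∀ k, dist (latticePoint k) (latticePoint l) = ‖latticePoint (k - l)‖ := by
    intro k
    rw [dist_eq_norm]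
    congr 1
    ext i
    simp [latticePoint]
  refine le_trans (le_of_eq ?_)
    (sum_exp_neg_mul_norm_latticePoint_le hn hδ (S.image fun k => k - l))
  rw [Finset.sum_image fun _ _ _ _ h => sub_left_injective h]
  simp only [e]

theorem measurableSet_unitCube (k : Fin n → ℤ) : MeasurableSet (unitCube k) := by
  have : unitCube k = ⋂ i, {x : EuclideanSpace ℝ (Fin n) | ⌊x i⌋ = k i} := by
    ext; simp [unitCube]
  rw [this]
  refine MeasurableSet.iInter fun i => ?_
  have h : Measurable fun x : EuclideanSpace ℝ (Fin n) => ⌊x i⌋ :=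
    Int.measurable_floor.comp (by fun_prop)
  exact h (measurableSet_singleton (k i))

theorem unitCube_subset_closedBall (k : Fin n → ℤ) :
    unitCube k ⊆ Metric.closedBall (latticePoint k) (Real.sqrt n) := by
  intro x hx
  rw [Metric.mem_closedBall, dist_eq_norm, EuclideanSpace.norm_eq]
  refine Real.sqrt_le_sqrt ?_
  have := Finset.sum_le_card_nsmul Finset.univ (fun i => ‖(x - latticePoint k) i‖ ^ 2) 1
    fun i _ => by
      have h1 := Int.floor_le (x i)
      have h2 := Int.lt_floor_add_one (x i)
      rw [hx i] at h1 h2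
      have h3 : (x - latticePoint k) i = x i - k i := by simp [latticePoint]
      rw [h3, Real.norm_eq_abs, sq_abs]
      nlinarith
  simpa using this

theorem pairwise_disjoint_unitCube : Pairwise fun k l : Fin n → ℤ =>
    Disjoint (unitCube k) (unitCube l) := by
  intro k l hkl
  refine Set.disjoint_left.2 fun x h1 h2 => hkl (funext fun i => ?_)
  rw [← h1 i, h2 i]

theorem measurableSet_biUnion_unitCube (S : Finset (Fin n → ℤ)) :
    MeasurableSet (⋃ k ∈ S, unitCube k) :=
  S.measurableSet_biUnion fun k _ => measurableSet_unitCube k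

theorem chi_biUnion_unitCube (S : Finset (Fin n → ℤ)) :
    chi _ (measurableSet_biUnion_unitCube S) =
      ∑ k ∈ S, chi (unitCube k) (measurableSet_unitCube k) := by
  classical
  induction S using Finset.induction_on with
  | empty => rw [Finset.sum_empty]; exact chi_empty _ (by simp)
  | insert k S hk ih =>
    rw [Finset.sum_insert hk, ← ih]
    refine mulOp_add _ _ _ fun x => ?_
    have hd : Disjoint (unitCube k) (⋃ l ∈ S, unitCube l) := by
      simp only [Set.disjoint_iUnion_right]
      exact fun l hl => pairwise_disjoint_unitCube fun h => hk (h ▸ hl)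
    rw [Finset.set_biUnion_insert, Set.indicator_union_of_disjoint hd]

theorem inner_chi_eq_setIntegral {D : Set (EuclideanSpace ℝ (Fin n))} (hD : MeasurableSet D)
    (f : L2Rn n) : inner ℂ f (chi D hD f) = ∫ x in D, inner ℂ (f x) (f x) := by
  rw [L2.inner_def, ← integral_indicator hD]
  refine integral_congr_ae ?_
  filter_upwards [coeFn_mulOp (memLp_top_indicator_one hD) f] with x e
  change inner ℂ (f x) (mulOp _ (memLp_top_indicator_one hD) f x) = _
  rw [e]
  by_cases h : x ∈ D <;> simp [h]

theorem tendsto_chi_biUnion_unitCube (f : L2Rn n) :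
    Tendsto (fun S : Finset (Fin n → ℤ) => chi _ (measurableSet_biUnion_unitCube S) f) atTop
      (𝓝 f) := by
  have hm := fun S : Finset (Fin n → ℤ) => (measurableSet_biUnion_unitCube S).compl
  have h1 : ∀ S, f - chi _ (measurableSet_biUnion_unitCube S) f = chi _ (hm S) f := by
    intro S
    have h2 : MemLp (fun _ : EuclideanSpace ℝ (Fin n) => (1 : ℂ)) ∞ volume := memLp_top_const 1
    have h3 : (1 : L2Rn n →L[ℂ] L2Rn n) =
        chi _ (measurableSet_biUnion_unitCube S) + chi _ (hm S) :=
      (mulOp_eq_one h2 fun _ => rfl).symm.trans (mulOp_add _ _ _ fun x => by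
        by_cases h : x ∈ ⋃ k ∈ S, unitCube k
        · rw [Set.indicator_of_mem h, Set.indicator_of_notMem (Set.notMem_compl_iff.2 h), add_zero]
        · rw [Set.indicator_of_notMem h, Set.indicator_of_mem (Set.mem_compl h), zero_add])
    rw [sub_eq_iff_eq_add']
    exact congrArg (fun T : L2Rn n →L[ℂ] L2Rn n => T f) h3
  have hlim := tendsto_setIntegral_of_antitone (μ := volume)
    (f := fun x => inner ℂ (f x) (f x)) hm
    (fun S T hST => Set.compl_subset_compl.2 (Set.biUnion_subset_biUnion_left hST))
    ⟨∅, (L2.integrable_inner f f).integrableOn⟩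
  have hempty : ⋂ S : Finset (Fin n → ℤ), (⋃ k ∈ S, unitCube k)ᶜ = ∅ := by
    refine Set.eq_empty_iff_forall_notMem.2 fun x hx => ?_
    have := Set.mem_iInter.1 hx {fun i => ⌊x i⌋}
    simp [unitCube] at this
  rw [hempty, Measure.restrict_empty, integral_zero_measure] at hlim
  simp only [← inner_chi_eq_setIntegral (hm _)] at hlim
  have h4 := (continuous_re.tendsto _).comp hlim
  have h5 : Tendsto (fun S => ‖chi _ (hm S) f‖ ^ 2) atTop (𝓝 0) := by
    simp only [norm_sq_chi]; exact h4
  rw [tendsto_iff_norm_sub_tendsto_zero]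
  have h6 := h5.sqrt
  simp only [Real.sqrt_sq (norm_nonneg _), Real.sqrt_zero] at h6
  refine h6.congr fun S => ?_
  rw [norm_sub_rev, h1]

theorem sum_norm_sq_chi_unitCube_le (S : Finset (Fin n → ℤ)) (f : L2Rn n) :
    ∑ k ∈ S, ‖chi _ (measurableSet_unitCube k) f‖ ^ 2 ≤ ‖f‖ ^ 2 := by
  have h : ∑ k ∈ S, ‖chi _ (measurableSet_unitCube k) f‖ ^ 2 =
      ‖chi _ (measurableSet_biUnion_unitCube S) f‖ ^ 2 := by
    rw [norm_sq_chi, chi_biUnion_unitCube, sum_apply, inner_sum, re_sum]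
    simp only [norm_sq_chi]
  rw [h]
  gcongr
  exact (ContinuousLinearMap.le_of_opNorm_le _ (norm_chi_le _) f).trans (by rw [one_mul])

/-- Schur's test: an operator whose blocks between unit cubes decay exponentially with the
distance of the cubes is bounded by the lattice sum of the block bounds. -/
theorem norm_le_of_norm_unitCube_block_le (hn : 0 < n) {δ D : ℝ} (hδ : 0 < δ) (hD : 0 ≤ D)
    (A : L2Rn n →L[ℂ] L2Rn n)
    (hA : ∀ k l, ‖chi _ (measurableSet_unitCube k) * A * chi _ (measurableSet_unitCube l)‖ ≤
      D * Real.exp (-δ * dist (latticePoint k) (latticePoint l))) :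
    ‖A‖ ≤ D * latticeSum δ n := by
  set L := latticeSum δ n
  have hL : 0 < L := latticeSum_pos δ n
  let Q := fun k : Fin n → ℤ => chi _ (measurableSet_unitCube k)
  have hQQ : ∀ k, Q k * Q k = Q k := fun k => chi_mul_chi _ _ _ (Set.inter_self _).symm
  let e := fun k l : Fin n → ℤ => Real.exp (-δ * dist (latticePoint k) (latticePoint l))
  have hblock : ∀ k l f g, ‖(inner ℂ (Q k f) (A (Q l g)))‖ ≤
      D * (e k l * ‖Q k f‖ * ‖Q l g‖) := by
    intro k l f g
    have e1 : inner ℂ (Q k f) (A (Q l g)) = inner ℂ (Q k f) ((Q k * A * Q l) (Q l g)) := by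
      have h1 : Q k f = Q k (Q k f) := congrArg (fun T : L2Rn n →L[ℂ] L2Rn n => T f) (hQQ k).symm
      have h2 : Q l (Q l g) = Q l g := congrArg (fun T : L2Rn n →L[ℂ] L2Rn n => T g) (hQQ l)
      change _ = inner ℂ (Q k f) (Q k (A (Q l (Q l g))))
      rw [h2]
      nth_rw 1 [h1]
      exact inner_chi_left _ _ _
    rw [e1]
    calc _ ≤ ‖Q k f‖ * ((D * e k l) * ‖Q l g‖) :=
        (norm_inner_le_norm _ _).trans (by
          gcongr; exact ContinuousLinearMap.le_of_opNorm_le _ (hA k l) _)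
      _ = _ := by ring
  have hfin : ∀ (S : Finset (Fin n → ℤ)) (f g : L2Rn n),
      ‖(inner ℂ (chi _ (measurableSet_biUnion_unitCube S) f)
        (A (chi _ (measurableSet_biUnion_unitCube S) g)))‖ ≤ D * L * ‖f‖ * ‖g‖ := by
    intro S f g
    have h1 : inner ℂ (chi _ (measurableSet_biUnion_unitCube S) f)
        (A (chi _ (measurableSet_biUnion_unitCube S) g)) =
        ∑ p ∈ S ×ˢ S, inner ℂ (Q p.1 f) (A (Q p.2 g)) := by
      rw [chi_biUnion_unitCube, Finset.sum_product]
      simp only [sum_apply, map_sum, sum_inner, inner_sum]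
      exact Finset.sum_comm
    have hcol : ∀ l, ∑ k ∈ S, e k l ≤ L := fun l => sum_exp_neg_mul_dist_le hn hδ S l
    have hrow : ∀ k, ∑ l ∈ S, e k l ≤ L := fun k => by
      simpa only [e, dist_comm (latticePoint k)] using hcol k
    have h2 : ∑ p ∈ S ×ˢ S, e p.1 p.2 * ‖Q p.1 f‖ ^ 2 ≤ L * ‖f‖ ^ 2 := by
      rw [Finset.sum_product]
      calc _ = ∑ k ∈ S, (∑ l ∈ S, e k l) * ‖Q k f‖ ^ 2 := by simp only [Finset.sum_mul]
        _ ≤ ∑ k ∈ S, L * ‖Q k f‖ ^ 2 := by gcongr with k; exact hrow k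
        _ ≤ L * ‖f‖ ^ 2 := by
          rw [← Finset.mul_sum]; gcongr; exact sum_norm_sq_chi_unitCube_le S f
    have h3 : ∑ p ∈ S ×ˢ S, e p.1 p.2 * ‖Q p.2 g‖ ^ 2 ≤ L * ‖g‖ ^ 2 := by
      rw [Finset.sum_product_right]
      calc _ = ∑ l ∈ S, (∑ k ∈ S, e k l) * ‖Q l g‖ ^ 2 := by simp only [Finset.sum_mul]
        _ ≤ ∑ l ∈ S, L * ‖Q l g‖ ^ 2 := by gcongr with l; exact hcol l
        _ ≤ L * ‖g‖ ^ 2 := by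
          rw [← Finset.mul_sum]; gcongr; exact sum_norm_sq_chi_unitCube_le S g
    have h4 : ∑ p ∈ S ×ˢ S, e p.1 p.2 * ‖Q p.1 f‖ * ‖Q p.2 g‖ ≤ L * ‖f‖ * ‖g‖ := by
      refine le_of_sq_le_sq ?_ (by positivity)
      calc _ ≤ (∑ p ∈ S ×ˢ S, e p.1 p.2 * ‖Q p.1 f‖ ^ 2) *
            ∑ p ∈ S ×ˢ S, e p.1 p.2 * ‖Q p.2 g‖ ^ 2 :=
          Finset.sum_sq_le_sum_mul_sum_of_sq_le_mul _ (fun _ _ => by positivity)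
            (fun _ _ => by positivity) fun _ _ => le_of_eq (by ring)
        _ ≤ (L * ‖f‖ ^ 2) * (L * ‖g‖ ^ 2) := by gcongr
        _ = _ := by ring
    rw [h1]
    calc _ ≤ ∑ p ∈ S ×ˢ S, D * (e p.1 p.2 * ‖Q p.1 f‖ * ‖Q p.2 g‖) :=
        norm_sum_le_of_le _ fun p _ => hblock p.1 p.2 f g
      _ = D * ∑ p ∈ S ×ˢ S, e p.1 p.2 * ‖Q p.1 f‖ * ‖Q p.2 g‖ := by rw [Finset.mul_sum]
      _ ≤ D * (L * ‖f‖ * ‖g‖) := by gcongr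
      _ = _ := by ring
  refine ContinuousLinearMap.opNorm_le_bound _ (by positivity) fun g => ?_
  have hlim := ((tendsto_chi_biUnion_unitCube (A g)).inner (𝕜 := ℂ)
    ((A.continuous.tendsto _).comp (tendsto_chi_biUnion_unitCube g))).norm
  have h5 : ‖(inner ℂ (A g) (A g))‖ ≤ D * L * ‖A g‖ * ‖g‖ :=
    le_of_tendsto' hlim fun S => hfin S (A g) g
  rw [inner_self_eq_norm_sq_to_K] at h5
  have h6 : ‖A g‖ * ‖A g‖ ≤ ‖A g‖ * (D * L * ‖g‖) := by
    have h7 : ‖A g‖ ^ 2 ≤ D * L * ‖A g‖ * ‖g‖ := by simpa using h5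
    nlinarith
  rcases (norm_nonneg (A g)).eq_or_lt with h0 | h0
  · rw [← h0]; positivity
  · exact le_of_mul_le_mul_left h6 h0

end Cubes

/-! ### The light cone estimate -/

section LightCone

variable {n : ℕ} {H : L2Rn n →ₗ.[ℂ] L2Rn n}

theorem setDist_comm (X Y : Set (EuclideanSpace ℝ (Fin n))) : setDist X Y = setDist Y X := by
  unfold setDist
  congr 1
  ext r
  constructor
  all_goals
    rintro ⟨x, hx, y, hy, rfl⟩
    exact ⟨y, hy, x, hx, dist_comm _ _⟩

theorem setDist_le_dist {X Y : Set (EuclideanSpace ℝ (Fin n))} {x y : EuclideanSpace ℝ (Fin n)}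
    (hx : x ∈ X) (hy : y ∈ Y) : setDist X Y ≤ dist x y :=
  csInf_le ⟨0, by rintro r ⟨x, -, y, -, rfl⟩; exact dist_nonneg⟩ ⟨x, hx, y, hy, rfl⟩

theorem IsUnitaryGroupOf.adjoint_eq {U : ℝ → L2Rn n →L[ℂ] L2Rn n} (hU : IsUnitaryGroupOf H U)
    (t : ℝ) : ContinuousLinearMap.adjoint (U t) = U (-t) := by
  have h1 : ContinuousLinearMap.adjoint (U t) * U t = 1 :=
    (ContinuousLinearMap.norm_map_iff_adjoint_comp_self _).1 (hU.norm_apply t)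
  have h2 : U t * U (-t) = 1 := by rw [← hU.add, add_neg_cancel, hU.zero]
  calc _ = ContinuousLinearMap.adjoint (U t) * (U t * U (-t)) := by rw [h2, mul_one]
    _ = U (-t) := by rw [← mul_assoc, h1, one_mul]

theorem IsUnitaryGroupOf.norm_chi_mul_chi_neg {U : ℝ → L2Rn n →L[ℂ] L2Rn n}
    (hU : IsUnitaryGroupOf H U) {X Y : Set (EuclideanSpace ℝ (Fin n))} (hX : MeasurableSet X)
    (hY : MeasurableSet Y) (t : ℝ) :
    ‖chi X hX * U (-t) * chi Y hY‖ = ‖chi Y hY * U t * chi X hX‖ := by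
  rw [← hU.adjoint_eq, ← LinearIsometryEquiv.norm_map ContinuousLinearMap.adjoint
    (chi Y hY * U t * chi X hX)]
  congr 1
  change _ = ContinuousLinearMap.adjoint ((chi Y hY ∘L U t) ∘L chi X hX)
  rw [ContinuousLinearMap.adjoint_comp, ContinuousLinearMap.adjoint_comp, adjoint_chi,
    adjoint_chi]
  rfl

theorem ConditionA.norm_chi_mul_chi_le_of_pos {a : ℝ} {F : (Fin n → ℂ) → L2Rn n →ₗ.[ℂ] L2Rn n}
    (hF : ConditionA H a F) (hH : IsSelfAdjoint H) {U : ℝ → L2Rn n →L[ℂ] L2Rn n}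
    (hU : IsUnitaryGroupOf H U) (hn : 0 < n) {μ μ' : ℝ} (hμ' : 0 < μ') (hμμ : μ' < μ)
    (hμa : μ < a) {X Y : Set (EuclideanSpace ℝ (Fin n))} (hX : MeasurableSet X)
    (hY : MeasurableSet Y) {t : ℝ} (ht : 0 < t) :
    ‖chi X hX * U t * chi Y hY‖ ≤
      Real.exp (μ * speed F μ * t - μ' * setDist X Y + 4 * μ * Real.sqrt n) *
        latticeSum (μ - μ') n := by
  have hμ : 0 < μ := hμ'.trans hμμ
  refine norm_le_of_norm_unitCube_block_le hn (sub_pos.2 hμμ) (Real.exp_pos _).le _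
    fun k l => ?_
  have hk := measurableSet_unitCube k
  have hl := measurableSet_unitCube l
  have e : chi _ hk * (chi X hX * U t * chi Y hY) * chi _ hl =
      chi _ (hk.inter hX) * U t * chi _ (hY.inter hl) := by
    rw [← chi_mul_chi hk hX (hk.inter hX) rfl, ← chi_mul_chi hY hl (hY.inter hl) rfl]
    simp only [mul_assoc]
  rw [e]
  rcases (unitCube k ∩ X).eq_empty_or_nonempty with h | ⟨x, hxk, hx⟩
  · rw [chi_empty _ h, zero_mul, zero_mul, norm_zero]; positivity
  rcases (Y ∩ unitCube l).eq_empty_or_nonempty with h | ⟨y, hy, hyl⟩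
  · rw [chi_empty _ h, mul_zero, norm_zero]; positivity
  refine (hF.norm_chi_mul_chi_le hH hU hn hμ hμa _ _
    (Set.inter_subset_left.trans (unitCube_subset_closedBall k))
    (Set.inter_subset_right.trans (unitCube_subset_closedBall l)) ht).trans ?_
  rw [← Real.exp_add]
  refine Real.exp_le_exp.2 ?_
  have h1 := setDist_le_dist hx hy
  have h2 := dist_triangle4 x (latticePoint k) (latticePoint l) y
  have h3 : dist x (latticePoint k) ≤ Real.sqrt n := unitCube_subset_closedBall k hxk
  have h4 : dist (latticePoint l) y ≤ Real.sqrt n := by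
    rw [dist_comm]; exact unitCube_subset_closedBall l hyl
  have h5 : μ' * setDist X Y ≤
      μ' * (dist (latticePoint k) (latticePoint l) + 2 * Real.sqrt n) := by
    gcongr; linarith
  have h6 : μ' * Real.sqrt n ≤ μ * Real.sqrt n := by gcongr
  nlinarith

end LightCone

theorem theorem1p1 :
    ∃ C : ℝ → ℝ → ℕ → ℝ, (∀ r μ n, 0 < C r μ n) ∧
      ∀ (n : ℕ) (H : L2Rn n →ₗ.[ℂ] L2Rn n) (_ : IsSelfAdjoint H)
        (U : ℝ → L2Rn n →L[ℂ] L2Rn n) (_ : IsUnitaryGroupOf H U)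
        (a : ℝ) (F : (Fin n → ℂ) → L2Rn n →ₗ.[ℂ] L2Rn n) (_ : ConditionA H a F)
        (μ μ' : ℝ) (_ : 0 < μ') (_ : μ' < μ) (_ : μ < a)
        (X Y : Set (EuclideanSpace ℝ (Fin n))) (hX : MeasurableSet X) (hY : MeasurableSet Y)
        (_ : Disjoint X Y) (t : ℝ),
        ‖chi X hX ∘L U t ∘L chi Y hY‖ ≤
          C (μ / μ' - 1) μ n *
            Real.exp (-μ' * (setDist X Y - μ * speed F μ / μ' * |t|)) := by
  -- With `r = μ / μ' - 1`, the decay rate `μ - μ'` of the block bounds equals `μ r / (r + 1)`.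
  refine ⟨fun r μ n => Real.exp (4 * μ * Real.sqrt n) * latticeSum (μ * r / (r + 1)) n,
    fun r μ n => mul_pos (Real.exp_pos _) (latticeSum_pos _ _), ?_⟩
  intro n H hH U hU a F hF μ μ' hμ' hμμ hμa X Y hX hY hXY t
  have hμ : 0 < μ := hμ'.trans hμμ
  have hrate : μ * (μ / μ' - 1) / (μ / μ' - 1 + 1) = μ - μ' := by
    rw [sub_add_cancel]; field_simp
  simp only [hrate]
  have hrhs : ∀ s : ℝ, Real.exp (4 * μ * Real.sqrt n) * latticeSum (μ - μ') n *
        Real.exp (-μ' * (setDist X Y - μ * speed F μ / μ' * s)) =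
      Real.exp (μ * speed F μ * s - μ' * setDist X Y + 4 * μ * Real.sqrt n) *
        latticeSum (μ - μ') n := by
    intro s
    have h1 : -μ' * (setDist X Y - μ * speed F μ / μ' * s) =
        μ * speed F μ * s - μ' * setDist X Y := by field_simp; ring
    rw [h1, Real.exp_add]; ring
  have hpos := latticeSum_pos (μ - μ') n
  change ‖chi X hX * (U t * chi Y hY)‖ ≤ _
  rw [← mul_assoc, hrhs]
  rcases n.eq_zero_or_pos with rfl | hn
  · -- In dimension `0` one of two disjoint sets is empty.
    have h0 : chi X hX * U t * chi Y hY = 0 := by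
      rcases X.eq_empty_or_nonempty with h | ⟨x, hx⟩
      · rw [chi_empty hX h, zero_mul, zero_mul]
      · have h : Y = ∅ := Set.eq_empty_iff_forall_notMem.2 fun y hy =>
          Set.disjoint_left.1 hXY hx (Subsingleton.elim y x ▸ hy)
        rw [chi_empty hY h, mul_zero]
    rw [h0, norm_zero]; positivity
  rcases lt_trichotomy t 0 with ht | rfl | ht
  · have h1 := hF.norm_chi_mul_chi_le_of_pos hH hU hn hμ' hμμ hμa hY hX (neg_pos.2 ht)
    rw [← hU.norm_chi_mul_chi_neg hX hY, neg_neg, setDist_comm] at h1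
    rwa [abs_of_neg ht]
  · have h0 : chi X hX * U 0 * chi Y hY = 0 := by
      rw [hU.zero, mul_one, chi_mul_chi hX hY (hX.inter hY) rfl]
      exact chi_empty _ hXY.inter_eq
    rw [h0, norm_zero]; positivity
  · rw [abs_of_pos ht]
    exact hF.norm_chi_mul_chi_le_of_pos hH hU hn hμ' hμμ hμa hX hY ht
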